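/- Let $N_c\ge 1$ and $N_f=N_c+1$. For fugacities $x=(x_1,\dots,x_{N_f-1})$ with non-zero complex entries put $w_1(x)=x_1$, $w_k(x)=x_k/x_{k-1}$ for $2\le k\le N_f-1$, and $w_{N_f}(x)=1/x_{N_f-1}$, so that $$[1,0,\dots,0]_x=\sum_{k=1}^{N_f} w_k(x),\qquad [0,\dots,0,1]_y=\sum_{k=1}^{N_f} w_k(y)^{-1}$$ are the characters of the fundamental and anti-fundamental representations of $SU(N_f)$. More generally, let $[a_1,\dots,a_{N_f-1}]_x$ be the character of the irreducible representation of $SU(N_f)$ with Dynkin label $[a_1,\dots,a_{N_f-1}]$; it is given by Weyl's character formula as the Laurent polynomial $$\det\big(w_i^{\lambda_j+N_f-j}\big)\big/\det\big(w_i^{N_f-j}\big),\qquad \lambda_j=\sum_{k=j}^{N_f-1}a_k ,$$ the quotient being taken as polynomials in independent variables $w_1,\dots,w_{N_f}$ before substituting $w_k=w_k(x)$. For a function $g$ of several variables let $\mathrm{PE}[g](v_1,\dots,v_n)=\exp\big(\sum_{r\ge1}\tfrac1r\,g(v_1^r,\dots,v_n^r)\big)$. The Hilbert series of $U(N_c)$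 SQCD with $N_f$ flavours is $$g_{N_f,U(N_c)}(t,\tilde t,x,y)=\frac{1}{N_c!\,(2\pi i)^{N_c}}\oint_{|z_1|=1}\frac{dz_1}{z_1}\cdots\oint_{|z_{N_c}|=1}\frac{dz_{N_c}}{z_{N_c}}\prod_{a<b}|z_a-z_b|^2\;\mathrm{PE}\Big[t\,[1,0,\dots,0]_x\sum_{a}z_a^{-1}+\tilde t\,[0,\dots,0,1]_y\sum_{a}z_a\Big].$$ (1) Let $t,\tilde t\in\mathbb C$ and let $x,y$ have non-zero entries, with $|t\,w_k(x)|<1$ and $|\tilde t\,w_k(y)^{-1}|<1$ for all $k$ (for instance $0\le t,\tilde t<1$ and $|x_i|=|y_i|=1$). Then the series in the plethystic exponentials converge, the integrand is integrable, and $$g_{N_f,U(N_c)}(t,\tilde t,x,y)=\big(1-(t\tilde t)^{N_f}\big)\,\mathrm{PE}\big[[1,0,\dots,0]_x\,[0,\dots,0,1]_y\;t\tilde t\,\big]=\sum_{n_1,\dots,n_{N_f-1}\ge 0}[n_1,n_2,\dots,n_{N_f-1}]_x\,[n_{N_f-1},\dots,n_2,n_1]_y\,(t\tilde t)^{\sum_{j=1}^{N_f-1}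 j n_j},$$ the last sum being unconditionally convergent. (2) For $|t|,|\tilde t|<1$ the unrefined Hilbert series, obtained by setting all $x_i=y_i=1$, is $$g_{N_f,U(N_c)}(t,\tilde t,1,1)=\frac{1-(t\tilde t)^{N_f}}{(1-t\tilde t)^{N_f^2}} .$$ -/

import Mathlib

noncomputable section

namespace SQCD

/-! ### Characters of `SU(r+1)` -/

/-- The weights of the fundamental representation of `SU(r+1)` in terms of the fugacities
`x₁, …, x_r`, that is `x₁, x₂ / x₁, …, x_r / x_{r-1}, 1 / x_r`. -/
def fundWeight {r : ℕ} (x : Fin r → ℂ) (k : Fin (r + 1)) : ℂ :=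
  (Fin.snoc x 1 : Fin (r + 1) → ℂ) k / (Fin.cons 1 x : Fin (r + 1) → ℂ) k

/-- The character `[1,0,…,0]_x` of the fundamental representation,
`x₁ + x₂ / x₁ + ⋯ + x_r / x_{r-1} + 1 / x_r`. -/
def fundChar {r : ℕ} (x : Fin r → ℂ) : ℂ := ∑ k, fundWeight x k

/-- The character `[0,…,0,1]_y` of the anti-fundamental representation,
`1 / y₁ + y₁ / y₂ + ⋯ + y_{r-1} / y_r + y_r`. -/
def antiFundChar {r : ℕ} (y : Fin r → ℂ) : ℂ := ∑ k, (fundWeight y k)⁻¹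

/-- The highest weight, in the coordinates of the diagonal matrices, of the irreducible
representation with Dynkin label `[a₁, …, a_r]`: its `j`-th entry is `a_j + a_{j+1} + ⋯ + a_r`,
and the last entry is `0`. -/
def highestWeight {r : ℕ} (a : Fin r → ℕ) (j : Fin (r + 1)) : ℕ :=
  ∑ k : Fin r, if (j : ℕ) ≤ (k : ℕ) then a k else 0

/-- The alternant `det (w_i ^ (l_j + n - j))` with `1 ≤ i, j ≤ n`, which is the sum
`∑ σ, sign σ • σ (w ^ (l + ρ))` over the Weyl group `S_n`, where `ρ = (n - 1, …, 1, 0)`. -/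
def alternant (n : ℕ) (l : Fin n → ℕ) : MvPolynomial (Fin n) ℤ :=
  (Matrix.of fun i j : Fin n =>
    (MvPolynomial.X i : MvPolynomial (Fin n) ℤ) ^ (l j + (Fin.rev j : ℕ))).det

/-- The Weyl denominator divides every alternant. -/
theorem alternant_zero_dvd (n : ℕ) (l : Fin n → ℕ) : alternant n 0 ∣ alternant n l := by
  nontriviality MvPolynomial (Fin n) ℤ
  let P : Polynomial (MvPolynomial (Fin n) ℤ) :=
    ∏ i : Fin n, (Polynomial.X - Polynomial.C (MvPolynomial.X i))
  have hP : P.Monic := Polynomial.monic_prod_of_monic _ _ fun i _ => Polynomial.monic_X_sub_C _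
  have hdeg : P.degree ≤ n := by
    have h : P.natDegree = n := by
      rw [Polynomial.natDegree_prod_of_monic _ _
        fun i _ => Polynomial.monic_X_sub_C (MvPolynomial.X i)]
      simp
    exact Polynomial.natDegree_le_iff_degree_le.1 h.le
  have key : (Matrix.of fun i j : Fin n =>
      (MvPolynomial.X i : MvPolynomial (Fin n) ℤ) ^ (l j + (Fin.rev j : ℕ))) =
      (Matrix.of fun i j : Fin n =>
        (MvPolynomial.X i : MvPolynomial (Fin n) ℤ) ^ ((0 : Fin n → ℕ) j + (Fin.rev j : ℕ))) *
      (Matrix.of fun k j : Fin n =>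
        ((Polynomial.X ^ (l j + (Fin.rev j : ℕ)) %ₘ P).coeff (Fin.rev k : ℕ))) := by
    ext1 i j
    rw [Matrix.mul_apply]
    simp only [Matrix.of_apply, Pi.zero_apply, zero_add]
    have hroot : P.eval (MvPolynomial.X i) = 0 := by
      simp only [P, Polynomial.eval_prod]
      exact Finset.prod_eq_zero (Finset.mem_univ i) (by simp)
    have h1 : (Polynomial.X ^ (l j + (Fin.rev j : ℕ)) %ₘ P).eval (MvPolynomial.X i) =
        (MvPolynomial.X i : MvPolynomial (Fin n) ℤ) ^ (l j + (Fin.rev j : ℕ)) := by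
      have h := congrArg (Polynomial.eval (MvPolynomial.X i))
        (Polynomial.modByMonic_add_div (Polynomial.X ^ (l j + (Fin.rev j : ℕ))) P)
      simpa [hroot] using h
    have h2 := congrArg (Polynomial.eval (MvPolynomial.X i))
      (Polynomial.sum_modByMonic_coeff (p := Polynomial.X ^ (l j + (Fin.rev j : ℕ))) hP hdeg)
    rw [← h1, ← h2, Polynomial.eval_finsetSum, ← Equiv.sum_comp Fin.revPerm]
    refine Finset.sum_congr rfl fun k _ => ?_
    simp [mul_comm]
  have hdet := congrArg Matrix.det key
  rw [Matrix.det_mul] at hdet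
  exact Dvd.intro _ hdet.symm

/-- The Weyl character formula of `GL(n)`: the quotient of the alternant of the highest weight `l`
by the Weyl denominator, taken in the polynomial ring. -/
def weylCharPoly (n : ℕ) (l : Fin n → ℕ) : MvPolynomial (Fin n) ℤ :=
  Classical.choose (alternant_zero_dvd n l)

theorem alternant_eq (n : ℕ) (l : Fin n → ℕ) :
    alternant n l = alternant n 0 * weylCharPoly n l :=
  Classical.choose_spec (alternant_zero_dvd n l)

/-- The character `[a₁, …, a_r]_x` of the irreducible representation of `SU(r+1)` with
Dynkin label `[a₁, …, a_r]`, as a Laurent polynomial function of the fugacities `x₁, …, x_r`. -/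
def dynkinChar {r : ℕ} (a : Fin r → ℕ) (x : Fin r → ℂ) : ℂ :=
  MvPolynomial.aeval (fundWeight x) (weylCharPoly (r + 1) (highestWeight a))

/-! ### The plethystic exponential -/

/-- `PE[g](v) = exp (∑_{r ≥ 1} g(v₁ ^ r, v₂ ^ r, …) / r)`, where the tuple of all the variables is an
element `v` of a product of copies of `ℂ`, and `v ^ r` is the componentwise power. -/
def PE {M : Type*} [Monoid M] (g : M → ℂ) (v : M) : ℂ :=
  Complex.exp (∑' r : ℕ, g (v ^ (r + 1)) / ((r : ℂ) + 1))

/-- Absolute convergence of the series in the plethystic exponential. -/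
def PEConverges {M : Type*} [Monoid M] (g : M → ℂ) (v : M) : Prop :=
  Summable fun r : ℕ => g (v ^ (r + 1)) / ((r : ℂ) + 1)

/-! ### The Hilbert series -/

/-- The character `t [1,0,…,0]_x ∑ z_a⁻¹ + t' [0,…,0,1]_y ∑ z_a` of the quarks and antiquarks, as a
function of all the fugacities `(t, t', x, y, z)`. -/
def quarkChar {r N : ℕ} (v : ℂ × ℂ × (Fin r → ℂ) × (Fin r → ℂ) × (Fin N → ℂ)) : ℂ :=
  match v with
  | (t, t', x, y, z) => t * fundChar x * ∑ a, (z a)⁻¹ + t' * antiFundChar y * ∑ a, z a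

/-- The character `[1,0,…,0;0,…,0,1]_{x;y} t t'` of the mesons, as a function of `(t, t', x, y)`. -/
def mesonChar {r : ℕ} (v : ℂ × ℂ × (Fin r → ℂ) × (Fin r → ℂ)) : ℂ :=
  match v with
  | (t, t', x, y) => fundChar x * antiFundChar y * (t * t')

/-- `|Δ_N(z)|² = ∏_{a < b} |z_a - z_b|²`. -/
def vandermondeSq {N : ℕ} (z : Fin N → ℂ) : ℝ :=
  ∏ a : Fin N, ∏ b ∈ Finset.Ioi a, ‖z a - z b‖ ^ 2

/-- Integration over `U(N)` of a class function, given as a function `f` of the eigenvalues: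
`1 / (N! (2πi)^N) ∮ dz₁/z₁ ⋯ ∮ dz_N/z_N |Δ_N(z)|² f(z)`. -/
def haarIntegral (N : ℕ) (f : (Fin N → ℂ) → ℂ) : ℂ :=
  1 / ((N.factorial : ℂ) * (2 * (Real.pi : ℂ) * Complex.I) ^ N) *
    torusIntegral (fun z => (∏ a, (z a)⁻¹) * (vandermondeSq z : ℂ) * f z) 0 1

/-- Convergence of the integral in `haarIntegral`. -/
def HaarIntegrable (N : ℕ) (f : (Fin N → ℂ) → ℂ) : Prop :=
  TorusIntegrable (fun z => (∏ a, (z a)⁻¹) * (vandermondeSq z : ℂ) * f z) 0 1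

/-- The Hilbert series `g_{N_f, U(N)}(t, t', x, y)` of `U(N)` SQCD with `N_f = r + 1` flavours. -/
def hilbertSeries (r N : ℕ) (t t' : ℂ) (x y : Fin r → ℂ) : ℂ :=
  haarIntegral N fun z => PE quarkChar (t, t', x, y, z)

end SQCD

end

/-! Put N = N_c, u_k = t w_k(x), v_k = t̃ w_k(y)⁻¹. The plethystic exponentials are products of
geometric series, so the integrand is a Cauchy kernel in u, v and z. Both sides of the identity come
from one signed double sum S over σ, τ in S_{N+1}, with terms ∏_a (1 - u_{σ(a+1)} v_{τ(a+1)})⁻¹.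

Integral: Cauchy's determinant with the extra node 0 (`sum_sign_prod_inv`) absorbs |Δ(z)|² and,
after multiplication by the Vandermondes of u and v, splits the integrand into products of
one-variable functions. Cauchy's integral formula then gives S, up to the factor (2πi)^N.

Evaluation: S is N! times a sum of determinants of the Cauchy matrix A with one row replaced by
ones. That sum is det A - det(A - J), with J the all-ones matrix, and det(A - J) = ∏u ∏v det A. This
produces the factor 1 - ∏u ∏v (`sum_sign_sign_prod_inv`), which is 1 - (t t̃)^{N+1} because the
weights multiply to 1.

Characters: expanding S in geometric series gives products of two alternants, indexed by exponents
that may be taken strictly increasing from 0, that is, by Dynkin labels. This is a Cauchy identity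
for Schur polynomials (`hasSum_schur_mul_schur`). Homogeneity extracts t and t̃, and `schur_inv`
turns inverse weights into the dual label.

The Vandermonde argument needs distinct u_k and distinct v_k; density and continuity remove this
restriction, with a uniform summable bound for the character series. -/

open Matrix Finset

/-! ### Cauchy determinants and signed sums over permutations -/

namespace Matrix

theorem _root_.inv_one_sub_mul_eq {K : Type*} [Field K] {a b c : K} (ha : 1 - a * c ≠ 0)
    (hb : 1 - b * c ≠ 0) :
    (1 - a * c)⁻¹ = (a - b) * c * ((1 - a * c)⁻¹ * (1 - b * c)⁻¹) + (1 - b * c)⁻¹ := by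
  linear_combination (1 - b * c)⁻¹ * inv_mul_cancel₀ ha - (1 - a * c)⁻¹ * inv_mul_cancel₀ hb

/-- Cauchy's determinant identity, with the denominators cleared. -/
theorem det_one_sub_mul_inv {K : Type*} [Field K] : ∀ {n : ℕ} (u v : Fin n → K),
    (∀ i j, 1 - u i * v j ≠ 0) →
    (of fun i j => (1 - u i * v j)⁻¹).det * ∏ i, ∏ j, (1 - u i * v j) =
      (vandermonde u).det * (vandermonde v).det
  | 0, u, v, _ => by simp
  | n + 1, u, v, h => by
    have ih := det_one_sub_mul_inv (fun i => u (Fin.succ i)) (fun i => v (Fin.succ i))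
      fun i j => h _ _
    -- Subtract row 0 from the others, pull out the common row and column factors, then do the same
    -- with column 0. What remains is the Cauchy matrix of the tails.
    have h1 : (of fun i j => (1 - u i * v j)⁻¹).det =
        (of fun i j : Fin (n + 1) => Fin.cases (1 - u 0 * v j)⁻¹
          (fun i => (u i.succ - u 0) * v j * ((1 - u i.succ * v j)⁻¹ * (1 - u 0 * v j)⁻¹)) i).det := by
      refine det_eq_of_forall_row_eq_smul_add_const (fun i => if i = 0 then 0 else 1) 0 (by simp) ?_
      intro i j
      refine Fin.cases ?_ (fun i => ?_) i
      · simp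
      · simpa using inv_one_sub_mul_eq (h i.succ j) (h 0 j)
    have h2 : (of fun i j : Fin (n + 1) => Fin.cases (1 - u 0 * v j)⁻¹
          (fun i => (u i.succ - u 0) * v j * ((1 - u i.succ * v j)⁻¹ * (1 - u 0 * v j)⁻¹)) i).det =
        (∏ j, (1 - u 0 * v j)⁻¹) * ((∏ i : Fin n, (u i.succ - u 0)) *
        (of fun i j : Fin (n + 1) => (Fin.cases 1
          (fun i => v j * (1 - u i.succ * v j)⁻¹) i : K)).det) := by
      have e1 := det_mul_column (fun i : Fin (n + 1) => (Fin.cases 1 (fun i => u i.succ - u 0) i : K))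
        (of fun i j : Fin (n + 1) => (Fin.cases 1 (fun i => v j * (1 - u i.succ * v j)⁻¹) i : K))
      rw [Fin.prod_univ_succ] at e1
      simp only [Fin.cases_zero, Fin.cases_succ, one_mul] at e1
      rw [← e1, ← det_mul_row]
      congr 1
      ext i j
      refine Fin.cases ?_ (fun i => ?_) i
      · simp
      · simp; ring
    have h3 : (of fun i j : Fin (n + 1) => (Fin.cases 1
          (fun i => v j * (1 - u i.succ * v j)⁻¹) i : K)).det =
        (of fun i j : Fin (n + 1) => (Fin.cases (Fin.cases 1 (fun _ => 0) j)
          (fun i => Fin.cases (v 0 * (1 - u i.succ * v 0)⁻¹) (fun j => (v j.succ - v 0) *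
            ((1 - u i.succ * v j.succ)⁻¹ * (1 - u i.succ * v 0)⁻¹)) j) i : K)).det := by
      rw [← det_transpose, ← det_transpose (of _)]
      refine det_eq_of_forall_row_eq_smul_add_const (fun i => if i = 0 then 0 else 1) 0 (by simp) ?_
      intro j i
      refine Fin.cases ?_ (fun i => ?_) i
      · refine Fin.cases ?_ (fun j => ?_) j <;> simp
      · refine Fin.cases ?_ (fun j => ?_) j
        · simp
        · have h1 := inv_mul_cancel₀ (h i.succ j.succ)
          have h2 := inv_mul_cancel₀ (h i.succ 0)
          simp only [transpose_apply, of_apply, Fin.cases_succ, Fin.cases_zero, Fin.succ_ne_zero,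
            if_false, one_mul]
          linear_combination v 0 * (1 - u i.succ * v 0)⁻¹ * h1 -
            v j.succ * (1 - u i.succ * v j.succ)⁻¹ * h2
    have h4 : (of fun i j : Fin (n + 1) => (Fin.cases (Fin.cases 1 (fun _ => 0) j)
          (fun i => Fin.cases (v 0 * (1 - u i.succ * v 0)⁻¹) (fun j => (v j.succ - v 0) *
            ((1 - u i.succ * v j.succ)⁻¹ * (1 - u i.succ * v 0)⁻¹)) j) i : K)).det =
        (∏ i : Fin n, (1 - u i.succ * v 0)⁻¹) * ((∏ i : Fin n, (v i.succ - v 0)) *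
        (of fun i j : Fin n => (1 - u i.succ * v j.succ)⁻¹).det) := by
      rw [det_succ_row_zero, Fin.sum_univ_succ, Finset.sum_eq_zero (by simp), ← det_mul_row,
        ← det_mul_column]
      simp only [of_apply, Fin.cases_zero, Fin.val_zero, pow_zero, one_mul, add_zero]
      congr 1
      ext i j
      simp
      ring
    have hV : ∀ w : Fin (n + 1) → K, (vandermonde w).det =
        (∏ i : Fin n, (w i.succ - w 0)) * (vandermonde fun i => w (Fin.succ i)).det := by
      intro w
      simp [det_vandermonde, Fin.prod_univ_succ, Fin.prod_Ioi_succ]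
    rw [hV u, hV v, h1, h2, h3, h4, Fin.prod_univ_succ (n := n) (f := fun i => ∏ j, (1 - u i * v j))]
    simp_rw [Fin.prod_univ_succ (fun j => 1 - u (Fin.succ _) * v j)]
    rw [Finset.prod_mul_distrib]
    have p1 : (∏ j, (1 - u 0 * v j)⁻¹) * ∏ j, (1 - u 0 * v j) = 1 := by
      rw [← Finset.prod_mul_distrib]
      exact Finset.prod_eq_one fun j _ => inv_mul_cancel₀ (h _ _)
    have p2 : (∏ i : Fin n, (1 - u i.succ * v 0)⁻¹) * ∏ i : Fin n, (1 - u i.succ * v 0) = 1 := by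
      rw [← Finset.prod_mul_distrib]
      exact Finset.prod_eq_one fun j _ => inv_mul_cancel₀ (h _ _)
    linear_combination (∏ i : Fin n, (u i.succ - u 0)) * (∏ i : Fin n, (v i.succ - v 0)) *
      ((∏ i : Fin n, (1 - u i.succ * v 0)⁻¹) * ∏ i : Fin n, (1 - u i.succ * v 0)) *
      ((of fun i j : Fin n => (1 - u i.succ * v j.succ)⁻¹).det *
        ∏ i : Fin n, ∏ j : Fin n, (1 - u i.succ * v j.succ)) * p1 +
      (∏ i : Fin n, (u i.succ - u 0)) * (∏ i : Fin n, (v i.succ - v 0)) *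
      ((of fun i j : Fin n => (1 - u i.succ * v j.succ)⁻¹).det *
        ∏ i : Fin n, ∏ j : Fin n, (1 - u i.succ * v j.succ)) * p2 +
      (∏ i : Fin n, (u i.succ - u 0)) * (∏ i : Fin n, (v i.succ - v 0)) * ih

/-- Row `σ 0` is missing from the product, so filling it with ones makes this a Leibniz expansion
after substituting `τ = π * σ`. -/
theorem sum_sign_mul_prod_succ {R : Type*} [CommRing R] {N : ℕ}
    (A : Matrix (Fin (N + 1)) (Fin (N + 1)) R) (σ : Equiv.Perm (Fin (N + 1))) :
    ∑ τ : Equiv.Perm (Fin (N + 1)), ((σ.sign : ℤ) : R) * ((τ.sign : ℤ) : R) *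
        ∏ a : Fin N, A (σ a.succ) (τ a.succ) =
      (A.updateRow (σ 0) 1).det := by
  rw [← det_transpose, det_apply', ← Equiv.sum_comp (Equiv.mulRight σ)]
  refine Finset.sum_congr rfl fun π _ => ?_
  have hs : ((σ.sign : ℤ) : R) * ((σ.sign : ℤ) : R) = 1 := by
    rcases Int.units_eq_one_or σ.sign with h | h <;> simp [h]
  rw [← Equiv.prod_comp σ, Fin.prod_univ_succ]
  have h1 : ∏ a : Fin N, A (σ a.succ) ((π * σ) a.succ) =
      ∏ a : Fin N, (A.updateRow (σ 0) 1)ᵀ (π (σ a.succ)) (σ a.succ) := by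
    refine Finset.prod_congr rfl fun a _ => ?_
    rw [transpose_apply, updateRow_ne (by simp [Fin.succ_ne_zero]), Equiv.Perm.mul_apply]
  simp only [Equiv.coe_mulRight, h1, transpose_apply, updateRow_self, Pi.one_apply,
    Equiv.Perm.sign_mul, Units.val_mul, Int.cast_mul]
  linear_combination ((π.sign : ℤ) : R) *
    (∏ a : Fin N, A.updateRow (σ 0) 1 (σ a.succ) (π (σ a.succ))) * hs

theorem sum_perm_apply_zero {R : Type*} [CommRing R] {N : ℕ} (g : Fin (N + 1) → R) :
    ∑ σ : Equiv.Perm (Fin (N + 1)), g (σ 0) = N.factorial * ∑ k, g k := by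
  rw [← Equiv.sum_comp Equiv.Perm.decomposeFin.symm, Fintype.sum_prod_type]
  simp [Equiv.Perm.decomposeFin_symm_apply_zero, Fintype.card_perm, Finset.mul_sum]

theorem sum_sign_sign_prod_succ {R : Type*} [CommRing R] {N : ℕ}
    (A : Matrix (Fin (N + 1)) (Fin (N + 1)) R) :
    ∑ σ : Equiv.Perm (Fin (N + 1)), ∑ τ : Equiv.Perm (Fin (N + 1)),
      ((σ.sign : ℤ) : R) * ((τ.sign : ℤ) : R) * ∏ a : Fin N, A (σ a.succ) (τ a.succ) =
      N.factorial * ∑ k, (A.updateRow k 1).det := by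
  simp_rw [sum_sign_mul_prod_succ]
  exact sum_perm_apply_zero fun k => (A.updateRow k 1).det

/-- By the matrix determinant lemma, subtracting the all-ones matrix lowers `A.det` by the sum of
all entries of the adjugate; Cramer's rule groups these entries into the determinants on the left.
-/
theorem sum_det_updateRow_one {K : Type*} [Field K] {n : ℕ} (A : Matrix (Fin n) (Fin n) K)
    (hA : A.det ≠ 0) :
    ∑ k, (A.updateRow k 1).det = A.det - (of fun i j => A i j - 1).det := by
  have h1 := det_add_replicateCol_mul_replicateRow (ι := Unit) (A := A) hA.isUnit
    (fun _ => -1) (fun _ => 1)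
  have h2 : A + replicateCol Unit (fun _ => (-1 : K)) * replicateRow Unit (fun _ => (1 : K)) =
      of fun i j => A i j - 1 := by
    ext i j
    simp [Matrix.mul_apply, sub_eq_add_neg]
  rw [h2] at h1
  rw [h1]
  have h3 : ∀ k, (A.updateRow k 1).det = ∑ i, A.adjugate i k := by
    intro k
    rw [← cramer_transpose_apply, cramer_eq_adjugate_mulVec, ← adjugate_transpose]
    simp [mulVec, dotProduct]
  simp_rw [h3]
  simp [Matrix.inv_def, Matrix.mul_apply, mul_add, hA, Finset.mul_sum]

/-- The alternating sum of the minors of a Cauchy matrix. -/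
theorem sum_sign_sign_prod_inv {N : ℕ} (u v : Fin (N + 1) → ℂ) (hu : Function.Injective u)
    (hv : Function.Injective v) (h : ∀ i j, 1 - u i * v j ≠ 0) :
    ∑ σ : Equiv.Perm (Fin (N + 1)), ∑ τ : Equiv.Perm (Fin (N + 1)),
      ((σ.sign : ℤ) : ℂ) * ((τ.sign : ℤ) : ℂ) *
        ∏ a : Fin N, (1 - u (σ a.succ) * v (τ a.succ))⁻¹ =
      N.factorial * ((1 - (∏ i, u i) * ∏ i, v i) * ∏ i, ∏ j, (1 - u i * v j)⁻¹) *
        ((vandermonde u).det * (vandermonde v).det) := by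
  have hC := det_one_sub_mul_inv u v h
  have hP : ∏ i, ∏ j, (1 - u i * v j) ≠ 0 :=
    Finset.prod_ne_zero_iff.2 fun i _ => Finset.prod_ne_zero_iff.2 fun j _ => h i j
  have hA : (of fun i j => (1 - u i * v j)⁻¹).det ≠ 0 := by
    refine left_ne_zero_of_mul (b := ∏ i, ∏ j, (1 - u i * v j)) ?_
    rw [hC]
    exact mul_ne_zero (det_vandermonde_ne_zero_iff.2 hu) (det_vandermonde_ne_zero_iff.2 hv)
  have h1 := sum_sign_sign_prod_succ (of fun i j => (1 - u i * v j)⁻¹)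
  rw [sum_det_updateRow_one _ hA] at h1
  simp only [of_apply] at h1
  -- Since 1/(1 - uv) - 1 = uv/(1 - uv), subtracting the ones only scales row i by `u i` and column
  -- j by `v j`.
  have h2 : (of fun i j => (1 - u i * v j)⁻¹ - 1).det =
      (∏ i, u i) * ((∏ i, v i) * (of fun i j => (1 - u i * v j)⁻¹).det) := by
    rw [← det_mul_row, ← det_mul_column]
    congr 1
    ext i j
    have := h i j
    simp
    field_simp
    ring
  rw [h1, h2, ← hC]
  simp_rw [Finset.prod_inv_distrib]
  field_simp

end Matrix

/-! ### Torus and circle integrals -/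

theorem torusIntegral_prod {n : ℕ} (f : Fin n → ℂ → ℂ) (c : Fin n → ℂ) (R : Fin n → ℝ) :
    torusIntegral (fun z => ∏ a, f a (z a)) c R = ∏ a, circleIntegral (f a) (c a) (R a) := by
  have h : (Set.Icc (0 : Fin n → ℝ) fun _ => 2 * Real.pi) =
      Set.univ.pi fun _ => Set.Icc (0 : ℝ) (2 * Real.pi) := by
    rw [Set.pi_univ_Icc]; rfl
  rw [torusIntegral, h, MeasureTheory.volume_pi, MeasureTheory.Measure.restrict_pi_pi]
  simp_rw [smul_eq_mul, ← Finset.prod_mul_distrib, torusMap]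
  rw [MeasureTheory.integral_fintype_prod_eq_prod (fun a (θ : ℝ) =>
    (R a * Complex.exp (θ * Complex.I) * Complex.I) *
      f a (c a + R a * Complex.exp (θ * Complex.I)))]
  refine Finset.prod_congr rfl fun a _ => ?_
  rw [circleIntegral_def_Icc]
  simp [circleMap]

theorem torusIntegral_congr {n : ℕ} {f g : (Fin n → ℂ) → ℂ}
    (h : ∀ z, (∀ a, ‖z a‖ = 1) → f z = g z) : torusIntegral f 0 1 = torusIntegral g 0 1 := by
  unfold torusIntegral
  congr 1
  ext θ
  rw [h]
  intro a
  simp [torusMap, Complex.norm_exp_ofReal_mul_I]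

theorem TorusIntegrable.congr {n : ℕ} {f g : (Fin n → ℂ) → ℂ}
    (hg : TorusIntegrable g 0 1) (h : ∀ z, (∀ a, ‖z a‖ = 1) → f z = g z) :
    TorusIntegrable f 0 1 := by
  have : (fun θ => f (torusMap 0 1 θ)) = fun θ => g (torusMap 0 1 θ) := by
    ext θ
    rw [h]
    intro a
    simp [torusMap, Complex.norm_exp_ofReal_mul_I]
  unfold TorusIntegrable
  rwa [this]

theorem torusIntegral_finset_sum {n : ℕ} {ι : Type*} (s : Finset ι) {f : ι → (Fin n → ℂ) → ℂ}
    {c : Fin n → ℂ} {R : Fin n → ℝ} (hf : ∀ i ∈ s, TorusIntegrable (f i) c R) :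
    torusIntegral (fun z => ∑ i ∈ s, f i z) c R = ∑ i ∈ s, torusIntegral (f i) c R := by
  unfold torusIntegral
  simp_rw [Finset.smul_sum]
  exact MeasureTheory.integral_finsetSum _ fun i hi => (hf i hi).function_integrable

theorem one_sub_ne_zero_of_norm_lt {a : ℂ} (h : ‖a‖ < 1) : 1 - a ≠ 0 := by
  intro h0
  rw [← sub_eq_zero.1 h0] at h
  simp at h

theorem norm_mul_lt_one {a b : ℂ} (ha : ‖a‖ < 1) (hb : ‖b‖ ≤ 1) : ‖a * b‖ < 1 := by
  rw [norm_mul]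
  exact mul_lt_one_of_nonneg_of_lt_one_left (norm_nonneg _) ha hb

/-- As z⁻¹(1 - u/z)⁻¹ = (z - u)⁻¹, this is Cauchy's integral formula for (1 - vz)⁻¹ at u. -/
theorem circleIntegral_inv_mul_geometric {u v : ℂ} (hu : ‖u‖ < 1) (hv : ‖v‖ < 1) :
    (∮ z in C(0, 1), z⁻¹ * ((1 - u * z⁻¹)⁻¹ * (1 - v * z)⁻¹)) =
      2 * Real.pi * Complex.I * (1 - u * v)⁻¹ := by
  have hd : DifferentiableOn ℂ (fun z : ℂ => (1 - v * z)⁻¹) (Metric.closedBall 0 1) := by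
    refine DifferentiableOn.inv (by fun_prop) fun z hz => ?_
    exact one_sub_ne_zero_of_norm_lt (norm_mul_lt_one hv (by simpa using hz))
  have h := DifferentiableOn.circleIntegral_sub_inv_smul hd (w := u) (by simpa using hu)
  rw [smul_eq_mul, mul_comm v u] at h
  rw [← h]
  refine circleIntegral.integral_congr zero_le_one fun z hz => ?_
  have hz0 : z ≠ 0 := by
    rintro rfl
    simp at hz
  simp only [smul_eq_mul]
  rw [← mul_assoc, ← mul_inv]
  congr 2
  field_simp

/-! ### The Haar integral of the Cauchy kernel -/

namespace SQCD

/-- The product of the Cauchy kernels `∏ (1 - u_k / z_a)⁻¹` and `∏ (1 - v_k z_a)⁻¹`. -/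
noncomputable def cauchyKernel {n N : ℕ} (u v : Fin n → ℂ) (z : Fin N → ℂ) : ℂ :=
  (∏ k, ∏ a, (1 - u k * (z a)⁻¹)⁻¹) * ∏ k, ∏ a, (1 - v k * z a)⁻¹

/-- Cauchy's determinant at the nodes (0, y): the node 0 gives a column of ones and adds only the
factor ∏ y to the Vandermonde determinant. This is how N + 1 flavours are matched with N colours. -/
theorem sum_sign_prod_inv {N : ℕ} (u : Fin (N + 1) → ℂ) (y : Fin N → ℂ)
    (h : ∀ k a, 1 - u k * y a ≠ 0) :
    ∑ σ : Equiv.Perm (Fin (N + 1)), ((σ.sign : ℤ) : ℂ) *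
        ∏ a : Fin N, (1 - u (σ a.succ) * y a)⁻¹ =
      (∏ k, ∏ a, (1 - u k * y a)⁻¹) * ((∏ a, y a) * ((vandermonde u).det * (vandermonde y).det)) := by
  have h1 := det_one_sub_mul_inv u (Fin.cons 0 y) fun i j => by
    refine Fin.cases ?_ (fun j => ?_) j
    · simp
    · simpa using h i j
  have hV : (vandermonde (Fin.cons 0 y : Fin (N + 1) → ℂ)).det =
      (∏ a, y a) * (vandermonde y).det := by
    rw [det_vandermonde, det_vandermonde, Fin.prod_univ_succ]
    simp [Fin.prod_Ioi_succ]
  rw [hV, det_apply'] at h1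
  simp only [of_apply, Fin.prod_univ_succ (fun i : Fin (N + 1) => (1 - u _ *
    (Fin.cons 0 y : Fin (N + 1) → ℂ) i)⁻¹), Fin.prod_univ_succ (fun i : Fin (N + 1) => (1 - u _ *
    (Fin.cons 0 y : Fin (N + 1) → ℂ) i)), Fin.cons_zero, Fin.cons_succ, mul_zero, sub_zero,
    inv_one, one_mul] at h1
  have hP : ∏ k, ∏ a, (1 - u k * y a) ≠ 0 :=
    Finset.prod_ne_zero_iff.2 fun i _ => Finset.prod_ne_zero_iff.2 fun j _ => h i j
  simp_rw [Finset.prod_inv_distrib] at h1 ⊢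
  rw [eq_inv_mul_iff_mul_eq₀ hP, mul_comm, h1]
  ring

theorem vandermondeSq_eq {N : ℕ} (z : Fin N → ℂ) (hz : ∀ a, ‖z a‖ = 1) :
    (vandermondeSq z : ℂ) = (vandermonde z).det * (vandermonde fun a => (z a)⁻¹).det := by
  simp_rw [det_vandermonde, ← Finset.prod_mul_distrib, vandermondeSq]
  push_cast
  refine Finset.prod_congr rfl fun a _ => Finset.prod_congr rfl fun b _ => ?_
  have h : ∀ a, (z a)⁻¹ = (starRingEnd ℂ) (z a) := fun a => Complex.inv_eq_conj (hz a)
  rw [h, h, ← map_sub, Complex.mul_conj, Complex.normSq_eq_norm_sq, norm_sub_rev]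
  push_cast
  rfl

theorem continuous_torus_kernel {ι : Type*} [TopologicalSpace ι] {u v : ι → ℂ} {N : ℕ}
    {z : ι → Fin N → ℂ} (hu : Continuous u) (hv : Continuous v) (hz : Continuous z)
    (hu1 : ∀ i, ‖u i‖ < 1) (hv1 : ∀ i, ‖v i‖ < 1) (hz1 : ∀ i a, ‖z i a‖ = 1) (a b : Fin N) :
    Continuous fun i => (1 - u i * (z i a)⁻¹)⁻¹ * (1 - v i * z i b)⁻¹ := by
  have h0 : ∀ a, Continuous fun i => z i a := fun a => (continuous_apply a).comp hz
  have hne : ∀ i, z i a ≠ 0 := fun i h => by simpa [h] using hz1 i a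
  refine ((continuous_const.sub (hu.mul ((h0 a).inv₀ hne))).inv₀ fun i => ?_).mul
    ((continuous_const.sub (hv.mul (h0 b))).inv₀ fun i => ?_)
  · exact one_sub_ne_zero_of_norm_lt (norm_mul_lt_one (hu1 i) (by simp [hz1]))
  · exact one_sub_ne_zero_of_norm_lt (norm_mul_lt_one (hv1 i) (by simp [hz1]))

/-- Letting u, v and z all depend on a parameter serves both integrability at fixed u, v and
continuity of the integral in u, v. -/
theorem continuous_cauchyKernel {ι : Type*} [TopologicalSpace ι] {n N : ℕ} {u v : ι → Fin n → ℂ}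
    {z : ι → Fin N → ℂ} (hu : Continuous u) (hv : Continuous v) (hz : Continuous z)
    (hu1 : ∀ i k, ‖u i k‖ < 1) (hv1 : ∀ i k, ‖v i k‖ < 1) (hz1 : ∀ i a, ‖z i a‖ = 1) :
    Continuous fun i => (∏ a, (z i a)⁻¹) * (vandermondeSq (z i) : ℂ) *
      cauchyKernel (u i) (v i) (z i) := by
  have h0 : ∀ a, Continuous fun i => z i a := fun a => (continuous_apply a).comp hz
  have hne : ∀ i a, z i a ≠ 0 := fun i a h => by simpa [h] using hz1 i a
  refine ((continuous_finsetProd _ fun a _ => (h0 a).inv₀ fun i => hne i a).mul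
    (Complex.continuous_ofReal.comp ?_)).mul ?_
  · unfold vandermondeSq
    exact continuous_finsetProd _ fun a _ => continuous_finsetProd _ fun b _ =>
      ((h0 a).sub (h0 b)).norm.pow 2
  · simp_rw [cauchyKernel, ← Finset.prod_mul_distrib]
    exact continuous_finsetProd _ fun k _ => continuous_finsetProd _ fun a _ =>
      continuous_torus_kernel ((continuous_apply k).comp hu) ((continuous_apply k).comp hv) hz
        (fun i => hu1 i k) (fun i => hv1 i k) hz1 a a

theorem norm_torusMap_zero_one {N : ℕ} (θ : Fin N → ℝ) (a : Fin N) : ‖torusMap 0 1 θ a‖ = 1 := by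
  simp [torusMap, Complex.norm_exp_ofReal_mul_I]

theorem continuous_torusMap {N : ℕ} (c : Fin N → ℂ) (R : Fin N → ℝ) :
    Continuous (torusMap c R) := by
  unfold torusMap
  fun_prop

theorem haarIntegrable_cauchyKernel {n N : ℕ} {u v : Fin n → ℂ} (hu : ∀ k, ‖u k‖ < 1)
    (hv : ∀ k, ‖v k‖ < 1) : HaarIntegrable N (cauchyKernel u v) :=
  (continuous_cauchyKernel continuous_const continuous_const (continuous_torusMap 0 1)
    (fun _ => hu) (fun _ => hv) norm_torusMap_zero_one).continuousOn.integrableOn_compact isCompact_Icc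

theorem haarIntegral_cauchyKernel_of_injective {N : ℕ} {u v : Fin (N + 1) → ℂ}
    (hu : ∀ k, ‖u k‖ < 1) (hv : ∀ k, ‖v k‖ < 1) (hui : Function.Injective u)
    (hvi : Function.Injective v) :
    haarIntegral N (cauchyKernel u v) =
      (1 - (∏ i, u i) * ∏ i, v i) * ∏ i, ∏ j, (1 - u i * v j)⁻¹ := by
  have hV : (vandermonde u).det * (vandermonde v).det ≠ 0 :=
    mul_ne_zero (det_vandermonde_ne_zero_iff.2 hui) (det_vandermonde_ne_zero_iff.2 hvi)
  have h1 := sum_sign_sign_prod_inv u v hui hvi fun i j =>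
    one_sub_ne_zero_of_norm_lt (norm_mul_lt_one (hu i) (hv j).le)
  have h2 : torusIntegral (fun z : Fin N → ℂ => ((vandermonde u).det * (vandermonde v).det) *
      ((∏ a, (z a)⁻¹) * (vandermondeSq z : ℂ) * cauchyKernel u v z)) 0 1 =
      ∑ σ : Equiv.Perm (Fin (N + 1)), ∑ τ : Equiv.Perm (Fin (N + 1)),
        torusIntegral (fun z => ((σ.sign : ℤ) : ℂ) * ((τ.sign : ℤ) : ℂ) * ∏ a : Fin N,
          ((z a)⁻¹ * ((1 - u (σ a.succ) * (z a)⁻¹)⁻¹ * (1 - v (τ a.succ) * z a)⁻¹))) 0 1 := by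
    have hint : ∀ σ τ : Equiv.Perm (Fin (N + 1)),
        TorusIntegrable (fun z => ((σ.sign : ℤ) : ℂ) * ((τ.sign : ℤ) : ℂ) * ∏ a : Fin N,
          ((z a)⁻¹ * ((1 - u (σ a.succ) * (z a)⁻¹)⁻¹ * (1 - v (τ a.succ) * z a)⁻¹))) 0 1 := by
      intro σ τ
      refine Continuous.integrableOn_Icc (continuous_const.mul
        (continuous_finsetProd _ fun a _ => Continuous.mul ?_ ?_))
      · refine Continuous.inv₀ ((continuous_apply a).comp (continuous_torusMap 0 1)) fun θ h => ?_
        have := norm_torusMap_zero_one θ a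
        simp [h] at this
      · exact continuous_torus_kernel continuous_const continuous_const (continuous_torusMap 0 1)
          (fun _ => hu _) (fun _ => hv _) norm_torusMap_zero_one a a
    simp_rw [← torusIntegral_finset_sum _ fun τ _ => hint _ τ]
    rw [← torusIntegral_finset_sum]
    · refine torusIntegral_congr fun z hz => ?_
      have e1 := sum_sign_prod_inv u (fun a => (z a)⁻¹) fun k a =>
        one_sub_ne_zero_of_norm_lt (norm_mul_lt_one (hu k) (by simp [hz]))
      have e2 := sum_sign_prod_inv v z fun k a =>
        one_sub_ne_zero_of_norm_lt (norm_mul_lt_one (hv k) (by simp [hz]))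
      -- The extra factors ∏ z⁻¹ and ∏ z, coming from `e1` and `e2`, cancel; the ∏ z⁻¹ of the
      -- measure stays.
      have e3 : (∏ a, z a) * ∏ a, (z a)⁻¹ = 1 := by
        rw [← Finset.prod_mul_distrib]
        exact Finset.prod_eq_one fun a _ => mul_inv_cancel₀ fun h => by simpa [h] using hz a
      have e4 : ∑ σ : Equiv.Perm (Fin (N + 1)), ∑ τ : Equiv.Perm (Fin (N + 1)),
          ((σ.sign : ℤ) : ℂ) * ((τ.sign : ℤ) : ℂ) * ∏ a : Fin N,
          ((z a)⁻¹ * ((1 - u (σ a.succ) * (z a)⁻¹)⁻¹ * (1 - v (τ a.succ) * z a)⁻¹)) =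
          (∏ a, (z a)⁻¹) * ((∑ σ : Equiv.Perm (Fin (N + 1)), ((σ.sign : ℤ) : ℂ) *
            ∏ a : Fin N, (1 - u (σ a.succ) * (z a)⁻¹)⁻¹) *
            ∑ σ : Equiv.Perm (Fin (N + 1)), ((σ.sign : ℤ) : ℂ) *
            ∏ a : Fin N, (1 - v (σ a.succ) * z a)⁻¹) := by
        rw [Finset.sum_mul_sum]
        simp_rw [Finset.mul_sum, Finset.prod_mul_distrib]
        refine Finset.sum_congr rfl fun σ _ => Finset.sum_congr rfl fun τ _ => by ring
      rw [e4, e1, e2, vandermondeSq_eq z hz, cauchyKernel]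
      linear_combination (-(∏ a, (z a)⁻¹) * ((vandermonde u).det * (vandermonde v).det) *
        ((vandermonde z).det * (vandermonde fun a => (z a)⁻¹).det) *
        ((∏ k, ∏ a, (1 - u k * (z a)⁻¹)⁻¹) * ∏ k, ∏ a, (1 - v k * z a)⁻¹)) * e3
    · intro σ _
      exact MeasureTheory.integrable_finsetSum _ fun τ _ => hint σ τ
  have h3 : ∀ σ τ : Equiv.Perm (Fin (N + 1)),
      torusIntegral (fun z => ((σ.sign : ℤ) : ℂ) * ((τ.sign : ℤ) : ℂ) * ∏ a : Fin N,
          ((z a)⁻¹ * ((1 - u (σ a.succ) * (z a)⁻¹)⁻¹ * (1 - v (τ a.succ) * z a)⁻¹))) 0 1 =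
      (2 * Real.pi * Complex.I) ^ N * (((σ.sign : ℤ) : ℂ) * ((τ.sign : ℤ) : ℂ) *
        ∏ a : Fin N, (1 - u (σ a.succ) * v (τ a.succ))⁻¹) := by
    intro σ τ
    rw [torusIntegral_const_mul, torusIntegral_prod fun a z =>
      (z⁻¹ * ((1 - u (σ (Fin.succ a)) * z⁻¹)⁻¹ * (1 - v (τ (Fin.succ a)) * z)⁻¹))]
    simp only [Pi.zero_apply, Pi.one_apply, circleIntegral_inv_mul_geometric (hu _) (hv _)]
    rw [Finset.prod_mul_distrib, Finset.prod_const, Finset.card_univ, Fintype.card_fin]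
    ring
  simp_rw [h3, ← Finset.mul_sum] at h2
  rw [h1, torusIntegral_const_mul] at h2
  have hpi : (2 * (Real.pi : ℂ) * Complex.I) ^ N ≠ 0 := pow_ne_zero _ Complex.two_pi_I_ne_zero
  have hN : (N.factorial : ℂ) ≠ 0 := Nat.cast_ne_zero.2 N.factorial_ne_zero
  rw [haarIntegral, one_div, inv_mul_eq_iff_eq_mul₀ (mul_ne_zero hN hpi)]
  refine mul_left_cancel₀ hV ?_
  rw [h2]
  ring

end SQCD

/-! ### Density of points with distinct coordinates, and extension by continuity -/

theorem Dense.eq_of_eventually {X Y : Type*} [TopologicalSpace X] [TopologicalSpace Y] [T2Space Y]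
    {S : Set X} (hS : Dense S) {F G : X → Y} {x : X} (hF : ContinuousAt F x)
    (hG : ContinuousAt G x) (h : ∀ᶠ w in nhds x, w ∈ S → F w = G w) : F x = G x := by
  have : (nhdsWithin x S).NeBot := mem_closure_iff_nhdsWithin_neBot.1 (hS x)
  refine tendsto_nhds_unique_of_eventuallyEq (l := nhdsWithin x S) (hF.mono_left nhdsWithin_le_nhds)
    (hG.mono_left nhdsWithin_le_nhds) ?_
  exact Filter.eventually_iff_exists_mem.2 ⟨_, inter_mem_nhdsWithin S h, fun w hw => hw.2 hw.1⟩

theorem dense_setOf_injective (n : ℕ) : Dense {w : Fin n → ℂ | Function.Injective w} := by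
  have h : {w : Fin n → ℂ | Function.Injective w} =
      ⋂ p : {p : Fin n × Fin n // p.1 ≠ p.2}, {w | w p.1.1 ≠ w p.1.2} := by
    ext w
    simp only [Set.mem_iInter, Set.mem_ofPred_eq, Subtype.forall, Prod.forall]
    exact ⟨fun hw a b hab => hw.ne hab, fun hw a b hab => by_contra fun hne => hw a b hne hab⟩
  rw [h]
  refine dense_iInter_of_isOpen (fun p => isOpen_ne_fun (by fun_prop) (by fun_prop)) fun p => ?_
  let L : (Fin n → ℂ) →L[ℂ] ℂ :=
    ContinuousLinearMap.proj (R := ℂ) (φ := fun _ : Fin n => ℂ) p.1.1 - ContinuousLinearMap.proj p.1.2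
  have hL : Function.Surjective L := fun c =>
    ⟨Pi.single p.1.1 c, by simp [L, Pi.single_eq_of_ne p.2.symm]⟩
  have e : {w : Fin n → ℂ | w p.1.1 ≠ w p.1.2} = L ⁻¹' {0}ᶜ :=
    Set.ext fun w => by simp [L, sub_eq_zero]
  rw [e]
  exact (dense_compl_singleton (0 : ℂ)).preimage (L.isOpenMap hL)

namespace SQCD

theorem isOpen_polydisc (n : ℕ) (R : ℝ) :
    IsOpen {p : (Fin n → ℂ) × (Fin n → ℂ) | (∀ k, ‖p.1 k‖ < R) ∧ ∀ k, ‖p.2 k‖ < R} := by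
  simp only [Set.ofPred_and, Set.ofPred_forall]
  exact (isOpen_iInter_of_finite fun k => isOpen_lt (by fun_prop) continuous_const).inter
    (isOpen_iInter_of_finite fun k => isOpen_lt (by fun_prop) continuous_const)

theorem continuousOn_haarIntegral_cauchyKernel (n N : ℕ) :
    ContinuousOn (fun p : (Fin n → ℂ) × (Fin n → ℂ) => haarIntegral N (cauchyKernel p.1 p.2))
      {p | (∀ k, ‖p.1 k‖ < 1) ∧ ∀ k, ‖p.2 k‖ < 1} := by
  rw [continuousOn_iff_continuous_domRestrict]
  have := (isOpen_polydisc n 1).locallyCompactSpace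
  refine continuous_const.mul ?_
  refine continuous_parametric_integral_of_continuous ?_ isCompact_Icc
  refine Continuous.smul (f := fun p : {p : (Fin n → ℂ) × (Fin n → ℂ) | (∀ k, ‖p.1 k‖ < 1) ∧
    ∀ k, ‖p.2 k‖ < 1} × (Fin N → ℝ) => ∏ i, ((1 : Fin N → ℝ) i : ℂ) *
      Complex.exp (p.2 i * Complex.I) * Complex.I) (by fun_prop) ?_
  exact continuous_cauchyKernel (by fun_prop) (by fun_prop)
    ((continuous_torusMap 0 1).comp continuous_snd) (fun i => i.1.2.1) (fun i => i.1.2.2)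
    fun i => norm_torusMap_zero_one _

theorem continuousOn_prod_one_sub_mul_inv (n : ℕ) :
    ContinuousOn (fun p : (Fin n → ℂ) × (Fin n → ℂ) =>
      (1 - (∏ i, p.1 i) * ∏ i, p.2 i) * ∏ i, ∏ j, (1 - p.1 i * p.2 j)⁻¹)
      {p | (∀ k, ‖p.1 k‖ < 1) ∧ ∀ k, ‖p.2 k‖ < 1} := by
  refine ContinuousOn.mul (by fun_prop) (continuousOn_finsetProd _ fun i _ =>
    continuousOn_finsetProd _ fun j _ => ContinuousOn.inv₀ (by fun_prop) fun p hp =>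
      one_sub_ne_zero_of_norm_lt (norm_mul_lt_one (hp.1 i) (hp.2 j).le))

/-- Both sides are continuous on the open polydisc and agree at the dense set of distinct
coordinates. Coinciding coordinates do matter: in the unrefined limit all weights are equal. -/
theorem haarIntegral_cauchyKernel {N : ℕ} {u v : Fin (N + 1) → ℂ}
    (hu : ∀ k, ‖u k‖ < 1) (hv : ∀ k, ‖v k‖ < 1) :
    haarIntegral N (cauchyKernel u v) =
      (1 - (∏ i, u i) * ∏ i, v i) * ∏ i, ∏ j, (1 - u i * v j)⁻¹ := by
  have hD := (isOpen_polydisc (N + 1) 1).mem_nhds (x := (u, v)) ⟨hu, hv⟩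
  refine ((dense_setOf_injective (N + 1)).prod (dense_setOf_injective (N + 1))).eq_of_eventually
    (x := (u, v)) ((continuousOn_haarIntegral_cauchyKernel (N + 1) N).continuousAt hD)
    ((continuousOn_prod_one_sub_mul_inv (N + 1)).continuousAt hD) ?_
  filter_upwards [hD] with p hp hi
  exact haarIntegral_cauchyKernel_of_injective hp.1 hp.2 hi.1 hi.2

end SQCD

/-- Norm summability is carried through the induction because multiplying by the next geometric
series requires it. -/
theorem hasSum_prod_pow {𝕜 : Type*} [NormedField 𝕜] [CompleteSpace 𝕜] {N : ℕ} {q : Fin N → 𝕜}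
    (h : ∀ a, ‖q a‖ < 1) :
    HasSum (fun m : Fin N → ℕ => ∏ a, q a ^ m a) (∏ a, (1 - q a)⁻¹) ∧
      Summable fun m : Fin N → ℕ => ‖∏ a, q a ^ m a‖ := by
  induction N with
  | zero =>
    refine ⟨?_, (hasSum_unique _).summable⟩
    simpa only [Finset.univ_eq_empty, Finset.prod_empty] using
      hasSum_unique fun _ : Fin 0 → ℕ => (1 : 𝕜)
  | succ N ih =>
    obtain ⟨h1, h2⟩ := ih fun a => h (Fin.succ a)
    have h3 := hasSum_geometric_of_norm_lt_one (h 0)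
    have h4 : Summable fun n : ℕ => ‖q 0 ^ n‖ := by
      simpa using summable_geometric_of_lt_one (norm_nonneg _) (h 0)
    have e : ∀ p : ℕ × (Fin N → ℕ), ∏ a, q a ^ (Fin.consEquiv (fun _ => ℕ) p a) =
        q 0 ^ p.1 * ∏ a : Fin N, q a.succ ^ p.2 a := fun p => by
      simp [Fin.prod_univ_succ, Fin.consEquiv]
    rw [← (Fin.consEquiv fun _ => ℕ).hasSum_iff, ← (Fin.consEquiv fun _ => ℕ).summable_iff]
    simp only [Function.comp_def, e]
    rw [Fin.prod_univ_succ]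
    have h5 := summable_mul_of_summable_norm h4 h2
    have h6 := h4.mul_norm h2
    have h7 := h3.mul h1 h5
    exact ⟨h7, h6⟩

/-! ### Schur polynomials: homogeneity and duality -/

namespace SQCD

/-- The Schur polynomial function with highest weight `l`. -/
noncomputable def schur {n : ℕ} (l : Fin n → ℕ) (w : Fin n → ℂ) : ℂ :=
  MvPolynomial.aeval w (weylCharPoly n l)

theorem det_pow_eq_mul_schur {n : ℕ} (l : Fin n → ℕ) (w : Fin n → ℂ) :
    (of fun i j : Fin n => w i ^ (l j + (Fin.rev j : ℕ))).det =
      (of fun i j : Fin n => w i ^ (Fin.rev j : ℕ)).det * schur l w := by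
  have h : ∀ l : Fin n → ℕ, MvPolynomial.aeval w (alternant n l) =
      (of fun i j : Fin n => w i ^ (l j + (Fin.rev j : ℕ))).det := by
    intro l
    rw [alternant, AlgHom.map_det]
    congr 1
    ext i j
    simp
  have h1 := congrArg (MvPolynomial.aeval w) (alternant_eq n l)
  rw [map_mul, h, h] at h1
  simpa [schur] using h1

theorem det_submatrix_rev {n : ℕ} (M : Matrix (Fin n) (Fin n) ℂ) :
    (of fun i j => M i (Fin.rev j)).det = ((Fin.revPerm (n := n)).sign : ℤ) * M.det :=
  det_permute' Fin.revPerm M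

theorem sign_revPerm_ne_zero (n : ℕ) : (((Fin.revPerm (n := n)).sign : ℤ) : ℂ) ≠ 0 := by
  rcases Int.units_eq_one_or (Fin.revPerm (n := n)).sign with h | h <;> simp [h]

theorem det_pow_rev {n : ℕ} (w : Fin n → ℂ) :
    (of fun i j : Fin n => w i ^ (Fin.rev j : ℕ)).det =
      ((Fin.revPerm (n := n)).sign : ℤ) * (vandermonde w).det :=
  det_submatrix_rev (vandermonde w)

theorem det_pow_rev_ne_zero {n : ℕ} {w : Fin n → ℂ} (hw : Function.Injective w) :
    (of fun i j : Fin n => w i ^ (Fin.rev j : ℕ)).det ≠ 0 := by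
  rw [det_pow_rev]
  exact mul_ne_zero (sign_revPerm_ne_zero n) (det_vandermonde_ne_zero_iff.2 hw)

/-- Putting the exponents in increasing order reverses the columns of both alternants, so the two
signs cancel. -/
theorem det_pow_eq_vandermonde_mul_schur {n : ℕ} (l : Fin n → ℕ) (w : Fin n → ℂ) :
    (of fun i j : Fin n => w i ^ (l (Fin.rev j) + (j : ℕ))).det =
      (vandermonde w).det * schur l w := by
  have h1 := det_submatrix_rev (of fun i j : Fin n => w i ^ (l (Fin.rev j) + (j : ℕ)))
  simp only [of_apply, Fin.rev_rev] at h1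
  rw [det_pow_eq_mul_schur, det_pow_rev, mul_assoc] at h1
  exact (mul_left_cancel₀ (sign_revPerm_ne_zero n) h1).symm

theorem continuous_schur {n : ℕ} (l : Fin n → ℕ) : Continuous (schur l) := by
  unfold schur
  simp_rw [MvPolynomial.aeval_def, MvPolynomial.eval₂_eq]
  fun_prop

theorem det_pow_const_mul {n : ℕ} (e : Fin n → ℕ) (c : ℂ) (w : Fin n → ℂ) :
    (of fun i j : Fin n => (c * w i) ^ e j).det =
      c ^ (∑ j, e j) * (of fun i j : Fin n => w i ^ e j).det := by
  rw [← Finset.prod_pow_eq_pow_sum, ← det_mul_row]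
  simp [mul_pow]

theorem schur_const_mul {n : ℕ} (l : Fin n → ℕ) (c : ℂ) (w : Fin n → ℂ) :
    schur l (fun i => c * w i) = c ^ (∑ j, l j) * schur l w := by
  refine ((dense_compl_singleton (0 : ℂ)).prod (dense_setOf_injective n)).eq_of_eventually
    (F := fun p : ℂ × (Fin n → ℂ) => schur l (fun i => p.1 * p.2 i))
    (G := fun p => p.1 ^ (∑ j, l j) * schur l p.2) (x := (c, w))
    ((continuous_schur l).comp (by fun_prop)).continuousAt
    (((continuous_fst.pow _).mul ((continuous_schur l).comp continuous_snd)).continuousAt)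
    (Filter.Eventually.of_forall ?_)
  rintro ⟨c, w⟩ ⟨hc, hw⟩
  have hc : c ≠ 0 := hc
  have h1 := det_pow_eq_mul_schur l (fun i => c * w i)
  rw [det_pow_const_mul, det_pow_const_mul, det_pow_eq_mul_schur, Finset.sum_add_distrib,
    pow_add] at h1
  refine mul_left_cancel₀ (mul_ne_zero (pow_ne_zero (∑ j : Fin n, (Fin.rev j : ℕ)) hc)
    (det_pow_rev_ne_zero hw)) ?_
  linear_combination -h1

theorem schur_conj {n : ℕ} (l : Fin n → ℕ) (w : Fin n → ℂ) :
    schur l (fun i => (starRingEnd ℂ) (w i)) = (starRingEnd ℂ) (schur l w) := by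
  unfold schur
  simp_rw [MvPolynomial.aeval_def, MvPolynomial.eval₂_eq]
  simp

theorem prod_pow_mul_det_inv_pow {n : ℕ} {w : Fin n → ℂ} (hw : ∀ i, w i ≠ 0) (e : Fin n → ℕ)
    (M : ℕ) (he : ∀ j, e j ≤ M) :
    (∏ i, w i) ^ M * (of fun i j : Fin n => (w i)⁻¹ ^ e j).det =
      (of fun i j : Fin n => w i ^ (M - e j)).det := by
  rw [← Finset.prod_pow, ← det_mul_column]
  congr 1
  ext i j
  simp only [of_apply]
  rw [pow_sub₀ _ (hw i) (he j), inv_pow]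

/-- Duality: clearing denominators in an alternant at w⁻¹ replaces each exponent e by L + n - 1 - e,
which is the alternant of the reversed complementary weight. -/
theorem schur_inv {n : ℕ} (l : Fin n → ℕ) {L : ℕ} (hL : ∀ j, l j ≤ L) {w : Fin n → ℂ}
    (hw : ∀ i, w i ≠ 0) :
    (∏ i, w i) ^ L * schur l (fun i => (w i)⁻¹) = schur (fun j => L - l (Fin.rev j)) w := by
  refine (dense_setOf_injective n).eq_of_eventually
    (F := fun w => (∏ i, w i) ^ L * schur l (fun i => (w i)⁻¹))
    (ContinuousAt.mul (by fun_prop) ((continuous_schur l).continuousAt.comp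
      (continuousAt_pi.2 fun i => (continuousAt_apply i w).inv₀ (hw i))))
    (continuous_schur _).continuousAt ?_
  have h0 : ∀ᶠ w' : Fin n → ℂ in nhds w, ∀ i, w' i ≠ 0 :=
    Filter.eventually_all.2 fun i => (continuousAt_apply i w).eventually_ne (hw i)
  filter_upwards [h0] with w hw hi
  have key : ∀ (l : Fin n → ℕ) (L : ℕ), (∀ j, l j ≤ L) → (∏ i, w i) ^ (L + (n - 1)) *
      (of fun i j : Fin n => (w i)⁻¹ ^ (l j + (Fin.rev j : ℕ))).det =
      (vandermonde w).det * schur (fun j => L - l (Fin.rev j)) w := by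
    intro l L hL
    rw [prod_pow_mul_det_inv_pow hw, ← det_pow_eq_vandermonde_mul_schur]
    · congr 1
      ext i j
      simp only [of_apply, Fin.rev_rev]
      congr 1
      have := hL j
      have := j.2
      simp only [Fin.val_rev]
      omega
    · intro j
      have := hL j
      simp only [Fin.val_rev]
      omega
  have k1 := key l L hL
  -- The zero weight gives the same relation for the Weyl denominator; comparing it with `k1` leaves
  -- the Schur polynomials.
  have k2 := key 0 0 (by simp)
  have h1 : schur (0 : Fin n → ℕ) w = 1 := by
    have h := det_pow_eq_mul_schur 0 w
    simp only [Pi.zero_apply, zero_add] at h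
    exact (mul_eq_left₀ (det_pow_rev_ne_zero hi)).1 h.symm
  have h2 : (fun j => 0 - (0 : Fin n → ℕ) (Fin.rev j)) = 0 := by
    ext; simp
  rw [h2, h1] at k2
  simp only [Pi.zero_apply, zero_add, mul_one] at k2
  rw [det_pow_eq_mul_schur l fun i => (w i)⁻¹, pow_add] at k1
  refine mul_left_cancel₀ (det_vandermonde_ne_zero_iff.2 hi) ?_
  rw [← k1, ← k2]
  ring

/-! ### Strictly increasing exponents and Dynkin labels -/

theorem highestWeight_last {N : ℕ} (a : Fin N → ℕ) : highestWeight a (Fin.last N) = 0 := by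
  simp [highestWeight]

theorem highestWeight_castSucc {N : ℕ} (a : Fin N → ℕ) (k : Fin N) :
    highestWeight a k.castSucc = a k + highestWeight a k.succ := by
  have h : a k = ∑ i, if i = k then a i else 0 := by simp
  rw [h, highestWeight, highestWeight, ← Finset.sum_add_distrib]
  refine Finset.sum_congr rfl fun i _ => ?_
  simp only [Fin.val_castSucc, Fin.val_succ, Fin.ext_iff]
  split_ifs <;> omega

/-- The exponents `l + ρ` of the highest weight `l` with Dynkin label `a`, in increasing order. -/
def shiftedWeight {N : ℕ} (a : Fin N → ℕ) (j : Fin (N + 1)) : ℕ :=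
  highestWeight a (Fin.rev j) + j

theorem shiftedWeight_zero {N : ℕ} (a : Fin N → ℕ) : shiftedWeight a 0 = 0 := by
  simp [shiftedWeight, highestWeight_last]

theorem shiftedWeight_succ {N : ℕ} (a : Fin N → ℕ) (j : Fin N) :
    shiftedWeight a j.succ = shiftedWeight a j.castSucc + a (Fin.rev j) + 1 := by
  simp only [shiftedWeight, Fin.rev_succ, Fin.rev_castSucc, highestWeight_castSucc, Fin.val_succ,
    Fin.val_castSucc]
  ring

theorem shiftedWeight_strictMono {N : ℕ} (a : Fin N → ℕ) : StrictMono (shiftedWeight a) :=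
  Fin.strictMono_iff_lt_succ.2 fun j => by rw [shiftedWeight_succ]; omega

theorem shiftedWeight_injective {N : ℕ} :
    Function.Injective (shiftedWeight : (Fin N → ℕ) → Fin (N + 1) → ℕ) := by
  intro a b h
  ext k
  have h1 := shiftedWeight_succ a (Fin.rev k)
  have h2 := shiftedWeight_succ b (Fin.rev k)
  rw [h, Fin.rev_rev] at h1
  rw [Fin.rev_rev] at h2
  omega

theorem exists_shiftedWeight_eq {N : ℕ} {c : Fin (N + 1) → ℕ} (hc : StrictMono c) (h0 : c 0 = 0) :
    ∃ a, shiftedWeight a = c := by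
  -- Dynkin labels are the gaps of the exponents, read backwards, less the 1 contributed by ρ.
  refine ⟨fun k => c (Fin.rev k).succ - c (Fin.rev k).castSucc - 1, ?_⟩
  ext j
  induction j using Fin.induction with
  | zero => rw [shiftedWeight_zero, h0]
  | succ j ih =>
    rw [shiftedWeight_succ, ih, Fin.rev_rev]
    have := hc (Fin.castSucc_lt_succ (i := j))
    omega

theorem shiftedWeight_succ_comp_injective (N : ℕ) :
    Function.Injective fun p : (Fin N → ℕ) × Equiv.Perm (Fin N) =>
      fun i => shiftedWeight p.1 (p.2 i).succ := by
  have hm : ∀ a : Fin N → ℕ, StrictMono fun i : Fin N => shiftedWeight a i.succ := fun a =>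
    (shiftedWeight_strictMono a).comp Fin.strictMono_succ
  rintro ⟨a, σ⟩ ⟨b, τ⟩ h
  have h1 : (fun i : Fin N => shiftedWeight a i.succ) = fun i : Fin N => shiftedWeight b i.succ := by
    refine ((hm a).range_inj (hm b)).1 ?_
    rw [← σ.surjective.range_comp, ← τ.surjective.range_comp fun i : Fin N => shiftedWeight b i.succ]
    exact congrArg Set.range h
  have hab : a = b := by
    refine shiftedWeight_injective (funext fun j => ?_)
    refine Fin.cases ?_ (fun i => congrFun h1 i) j
    rw [shiftedWeight_zero, shiftedWeight_zero]
  subst hab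
  congr 1
  exact Equiv.ext fun i => (hm a).injective (congrFun h i)

/-- Sorting m and prepending 0 gives a strictly increasing sequence, hence a label; the sorting
permutation recovers m. -/
theorem mem_range_shiftedWeight_succ_comp {N : ℕ} {m : Fin N → ℕ} (hm : Function.Injective m)
    (h0 : ∀ i, m i ≠ 0) :
    m ∈ Set.range fun p : (Fin N → ℕ) × Equiv.Perm (Fin N) =>
      fun i => shiftedWeight p.1 (p.2 i).succ := by
  have h1 : StrictMono (m ∘ Tuple.sort m) :=
    (Tuple.monotone_sort m).strictMono_of_injective (hm.comp (Tuple.sort m).injective)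
  have h2 : StrictMono (Fin.cons 0 (m ∘ Tuple.sort m) : Fin (N + 1) → ℕ) := by
    intro i j hij
    obtain ⟨j, rfl⟩ := Fin.exists_succ_eq.2 (Fin.ne_zero_of_lt hij)
    refine Fin.cases (fun _ => ?_) (fun i hij => ?_) i hij
    · simpa [Nat.pos_iff_ne_zero] using h0 _
    · simpa using h1 (Fin.succ_lt_succ_iff.1 hij)
  obtain ⟨a, ha⟩ := exists_shiftedWeight_eq h2 rfl
  refine ⟨(a, (Tuple.sort m).symm), funext fun i => ?_⟩
  simp [ha]

/-- The support of f consists of tuples of distinct positive exponents. Each is a unique permutation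
of the exponents of a unique label, so by symmetry each label collects N! equal terms. -/
theorem hasSum_shiftedWeight {N : ℕ} {f : (Fin N → ℕ) → ℂ} {S : ℂ} (hf : HasSum f S)
    (hσ : ∀ m (σ : Equiv.Perm (Fin N)), f (fun i => m (σ i)) = f m)
    (h0 : ∀ m, f m ≠ 0 → Function.Injective m ∧ ∀ i, m i ≠ 0) :
    HasSum (fun a : Fin N → ℕ => N.factorial * f fun i => shiftedWeight a i.succ) S := by
  rw [← (shiftedWeight_succ_comp_injective N).hasSum_iff] at hf
  · refine hf.prod_fiberwise fun a => ?_
    have h := hasSum_fintype fun _ : Equiv.Perm (Fin N) => f fun i => shiftedWeight a i.succ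
    simp only [Finset.sum_const, Finset.card_univ, Fintype.card_perm, Fintype.card_fin,
      nsmul_eq_mul] at h
    refine h.congr_fun fun σ => ?_
    exact hσ (fun i => shiftedWeight a i.succ) σ
  · intro m hm
    by_contra h
    exact hm (mem_range_shiftedWeight_succ_comp (h0 m h).1 (h0 m h).2)

theorem sum_highestWeight {N : ℕ} (a : Fin N → ℕ) :
    ∑ j, highestWeight a j = ∑ j : Fin N, ((j : ℕ) + 1) * a j := by
  unfold highestWeight
  rw [Finset.sum_comm]
  refine Finset.sum_congr rfl fun k _ => ?_
  rw [← Finset.sum_filter, Finset.sum_const, smul_eq_mul]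
  congr 1
  have : (Finset.univ.filter fun j : Fin (N + 1) => (j : ℕ) ≤ k) = Finset.Iic k.castSucc := by
    ext j
    simp [Fin.le_def]
  rw [this, Fin.card_Iic]
  simp

/-- Reversing the Dynkin label yields the complementary weight that appears in `schur_inv`. -/
theorem highestWeight_comp_rev {N : ℕ} (a : Fin N → ℕ) (j : Fin (N + 1)) :
    highestWeight (fun k => a (Fin.rev k)) j = highestWeight a 0 - highestWeight a (Fin.rev j) := by
  refine Nat.eq_sub_of_add_eq ?_
  rw [highestWeight, ← Equiv.sum_comp Fin.revPerm, highestWeight, highestWeight,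
    ← Finset.sum_add_distrib]
  refine Finset.sum_congr rfl fun k _ => ?_
  simp only [Fin.revPerm_apply, Fin.rev_rev, Fin.val_rev, Fin.val_zero, Nat.zero_le, if_true]
  split_ifs <;> omega

theorem highestWeight_le {N : ℕ} (a : Fin N → ℕ) (j : Fin (N + 1)) :
    highestWeight a j ≤ highestWeight a 0 :=
  Finset.sum_le_sum fun k _ => by split_ifs <;> simp_all

/-! ### The Cauchy identity -/

/-- Expand both determinants by Leibniz and sum the geometric series in each `m a`. The exponent 0
in the first column is why `σ 0` and `τ 0` drop out. -/
theorem hasSum_det_mul_det {N : ℕ} {u v : Fin (N + 1) → ℂ} (hu : ∀ k, ‖u k‖ < 1)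
    (hv : ∀ k, ‖v k‖ < 1) :
    HasSum (fun m : Fin N → ℕ =>
      (of fun i j => u i ^ (Fin.cons 0 m : Fin (N + 1) → ℕ) j).det *
      (of fun i j => v i ^ (Fin.cons 0 m : Fin (N + 1) → ℕ) j).det)
      (∑ σ : Equiv.Perm (Fin (N + 1)), ∑ τ : Equiv.Perm (Fin (N + 1)),
      ((σ.sign : ℤ) : ℂ) * ((τ.sign : ℤ) : ℂ) *
        ∏ a : Fin N, (1 - u (σ a.succ) * v (τ a.succ))⁻¹) := by
  have h : ∀ m : Fin N → ℕ, (of fun i j => u i ^ (Fin.cons 0 m : Fin (N + 1) → ℕ) j).det *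
      (of fun i j => v i ^ (Fin.cons 0 m : Fin (N + 1) → ℕ) j).det =
      ∑ σ : Equiv.Perm (Fin (N + 1)), ∑ τ : Equiv.Perm (Fin (N + 1)),
      ((σ.sign : ℤ) : ℂ) * ((τ.sign : ℤ) : ℂ) *
        ∏ a : Fin N, (u (σ a.succ) * v (τ a.succ)) ^ m a := by
    intro m
    rw [det_apply', det_apply', Finset.sum_mul_sum]
    refine Finset.sum_congr rfl fun σ _ => Finset.sum_congr rfl fun τ _ => ?_
    simp only [of_apply, Fin.prod_univ_succ, Fin.cons_zero, Fin.cons_succ, pow_zero, one_mul,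
      mul_pow, Finset.prod_mul_distrib]
    ring
  simp_rw [h]
  exact hasSum_sum fun σ _ => hasSum_sum fun τ _ => (hasSum_prod_pow fun a =>
    norm_mul_lt_one (hu _) (hv _).le).1.mul_left _

theorem hasSum_schur_mul_schur_of_injective {N : ℕ} {u v : Fin (N + 1) → ℂ} (hu : ∀ k, ‖u k‖ < 1)
    (hv : ∀ k, ‖v k‖ < 1) (hui : Function.Injective u) (hvi : Function.Injective v) :
    HasSum (fun a : Fin N → ℕ => schur (highestWeight a) u * schur (highestWeight a) v)
      ((1 - (∏ i, u i) * ∏ i, v i) * ∏ i, ∏ j, (1 - u i * v j)⁻¹) := by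
  have h := hasSum_det_mul_det hu hv
  rw [sum_sign_sign_prod_inv u v hui hvi fun i j =>
    one_sub_ne_zero_of_norm_lt (norm_mul_lt_one (hu i) (hv j).le)] at h
  have h2 := hasSum_shiftedWeight h ?_ ?_
  · have hV : (vandermonde u).det * (vandermonde v).det ≠ 0 :=
      mul_ne_zero (det_vandermonde_ne_zero_iff.2 hui) (det_vandermonde_ne_zero_iff.2 hvi)
    have hN : (N.factorial : ℂ) ≠ 0 := Nat.cast_ne_zero.2 N.factorial_ne_zero
    have hE : ∀ (a : Fin N → ℕ) (w : Fin (N + 1) → ℂ),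
        (of fun i j => w i ^ (Fin.cons 0 (fun i => shiftedWeight a i.succ) : Fin (N + 1) → ℕ) j).det =
        (vandermonde w).det * schur (highestWeight a) w := by
      intro a w
      have : (Fin.cons 0 (fun i => shiftedWeight a i.succ) : Fin (N + 1) → ℕ) =
          fun j => highestWeight a (Fin.rev j) + (j : ℕ) := by
        ext j
        refine Fin.cases ?_ (fun i => ?_) j
        · exact (shiftedWeight_zero a).symm
        · rfl
      rw [← det_pow_eq_vandermonde_mul_schur, this]
    simp_rw [hE] at h2
    refine (hasSum_mul_left_iff (mul_ne_zero hN hV)).1 ?_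
    rw [mul_right_comm]
    exact h2.congr_fun fun a => by ring
  -- Permuting m permutes the columns of both determinants, and the two equal signs multiply to 1.
  · intro m σ
    have hE : ∀ w : Fin (N + 1) → ℂ,
        (of fun i j => w i ^ (Fin.cons 0 (fun i => m (σ i)) : Fin (N + 1) → ℕ) j).det =
        ((Equiv.Perm.decomposeFin.symm (0, σ)).sign : ℤ) *
        (of fun i j => w i ^ (Fin.cons 0 m : Fin (N + 1) → ℕ) j).det := by
      intro w
      rw [← det_permute']
      congr 1
      ext i j
      refine Fin.cases ?_ (fun i => ?_) j <;> simp
    rw [hE, hE]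
    rcases Int.units_eq_one_or (Equiv.Perm.decomposeFin.symm ((0 : Fin (N + 1)), σ)).sign with h | h <;>
      simp [h]
  -- A repeated exponent, or a zero one (which duplicates the prepended 0), makes two columns equal.
  · intro m hm
    have hd := left_ne_zero_of_mul hm
    constructor
    · intro i j hij
      by_contra hne
      refine hd (det_zero_of_column_eq (i := i.succ) (j := j.succ) (by simpa using hne) fun k => ?_)
      simp [hij]
    · intro i hi
      refine hd (det_zero_of_column_eq (i := i.succ) (j := 0) (Fin.succ_ne_zero i) fun k => ?_)
      simp [hi]


/-- Taking v to be the conjugate of u makes every term of the Cauchy identity a squared modulus, so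
a single term is at most the whole sum. The 2 bounds |1 - ∏u ∏v|. -/
theorem norm_schur_sq_le {N : ℕ} {s : ℝ} (hs1 : s < 1) {w : Fin (N + 1) → ℂ}
    (hw : ∀ k, ‖w k‖ < s) (a : Fin N → ℕ) :
    ‖schur (highestWeight a) w‖ ^ 2 ≤
      2 * ∏ _i : Fin (N + 1), ∏ _j : Fin (N + 1), (1 - s ^ 2)⁻¹ := by
  have hne : (nhdsWithin w {w | Function.Injective w}).NeBot :=
    mem_closure_iff_nhdsWithin_neBot.1 (dense_setOf_injective (N + 1) w)
  refine le_of_tendsto (f := fun w => ‖schur (highestWeight a) w‖ ^ 2)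
    (x := nhdsWithin w {w | Function.Injective w})
    (((continuous_schur _).norm.pow 2).continuousAt.mono_left nhdsWithin_le_nhds) ?_
  have h0 : ∀ᶠ w' : Fin (N + 1) → ℂ in nhds w, ∀ i, ‖w' i‖ < s :=
    Filter.eventually_all.2 fun i =>
      (continuousAt_apply i w).norm.eventually_lt continuousAt_const (hw i)
  filter_upwards [nhdsWithin_le_nhds h0, self_mem_nhdsWithin] with w hw hi
  have hi : Function.Injective w := hi
  have h1 : ∀ k, ‖w k‖ < 1 := fun k => (hw k).trans hs1
  have hs0 : 0 < s := (norm_nonneg _).trans_lt (hw 0)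
  have h := hasSum_schur_mul_schur_of_injective h1
    (v := fun k => (starRingEnd ℂ) (w k)) (by simpa using h1) hi
    ((starRingEnd ℂ).injective.comp hi)
  simp only [schur_conj, Complex.mul_conj, Complex.normSq_eq_norm_sq] at h
  have h2 := Complex.hasSum_re h
  simp only [Complex.ofReal_re] at h2
  refine (le_hasSum h2 a fun b _ => sq_nonneg _).trans ((Complex.re_le_norm _).trans ?_)
  rw [norm_mul, norm_prod]
  simp_rw [norm_prod]
  refine mul_le_mul ?_ ?_ (by positivity) (by positivity)
  · refine (norm_sub_le _ _).trans ?_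
    rw [norm_one, norm_mul, norm_prod, norm_prod]
    have hp : ∏ i, ‖w i‖ ≤ 1 := Finset.prod_le_one (fun _ _ => norm_nonneg _) fun i _ => (h1 i).le
    have hq : ∏ i, ‖(starRingEnd ℂ) (w i)‖ ≤ 1 := by simpa using hp
    have := mul_le_one₀ hp (by positivity) hq
    linarith
  · refine Finset.prod_le_prod (fun _ _ => by positivity) fun i _ =>
      Finset.prod_le_prod (fun _ _ => by positivity) fun j _ => ?_
    rw [norm_inv]
    have h3 : ‖w i * (starRingEnd ℂ) (w j)‖ ≤ s ^ 2 := by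
      rw [norm_mul, RCLike.norm_conj, sq]
      exact mul_le_mul (hw i).le (hw j).le (norm_nonneg _) hs0.le
    have h4 := norm_sub_norm_le (1 : ℂ) (w i * (starRingEnd ℂ) (w j))
    rw [norm_one] at h4
    have h5 : 0 < 1 - s ^ 2 := by nlinarith
    exact inv_anti₀ h5 (by linarith)

/-- Rescaling w by s⁻¹ keeps it inside radius s, and homogeneity then supplies s^{2|λ|}, with |λ| =
∑ (j+1) a_j ≥ ∑ a_j: geometric decay in the label. -/
theorem norm_schur_le {N : ℕ} {s : ℝ} (hs0 : 0 < s) (hs1 : s < 1) {w : Fin (N + 1) → ℂ}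
    (hw : ∀ k, ‖w k‖ < s ^ 2) (a : Fin N → ℕ) :
    ‖schur (highestWeight a) w‖ ^ 2 ≤ (2 * ∏ _i : Fin (N + 1), ∏ _j : Fin (N + 1), (1 - s ^ 2)⁻¹) *
      ∏ k : Fin N, (s ^ 2) ^ a k := by
  have h1 : w = fun k => (s : ℂ) * ((s : ℂ)⁻¹ * w k) := by
    ext k
    rw [mul_inv_cancel_left₀ (by exact_mod_cast hs0.ne')]
  have h2 := norm_schur_sq_le hs1 (w := fun k => (s : ℂ)⁻¹ * w k) (fun k => by
    rw [norm_mul, norm_inv, Complex.norm_real, Real.norm_of_nonneg hs0.le, inv_mul_lt_iff₀ hs0, ← sq]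
    exact hw k) a
  rw [h1, schur_const_mul, norm_mul, mul_pow, norm_pow, Complex.norm_real,
    Real.norm_of_nonneg hs0.le, mul_comm, ← pow_mul, mul_comm (∑ j, _), pow_mul,
    Finset.prod_pow_eq_pow_sum]
  refine mul_le_mul h2 (pow_le_pow_of_le_one (by positivity) (by nlinarith) ?_) (by positivity)
    ((sq_nonneg _).trans h2)
  rw [sum_highestWeight]
  exact Finset.sum_le_sum fun k _ => Nat.le_mul_of_pos_left _ (Nat.succ_pos _)

theorem exists_norm_lt_sq {n : ℕ} {u v : Fin (n + 1) → ℂ} (hu : ∀ k, ‖u k‖ < 1)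
    (hv : ∀ k, ‖v k‖ < 1) :
    ∃ s : ℝ, 0 < s ∧ s < 1 ∧ (∀ k, ‖u k‖ < s ^ 2) ∧ ∀ k, ‖v k‖ < s ^ 2 := by
  obtain ⟨i, hi⟩ := Finite.exists_max fun k => ‖u k‖
  obtain ⟨j, hj⟩ := Finite.exists_max fun k => ‖v k‖
  obtain ⟨r, hr1, hr2⟩ := exists_between (max_lt (hu i) (hv j))
  have hr0 : 0 < r := (norm_nonneg _).trans_lt ((le_max_left _ _).trans_lt hr1)
  refine ⟨√r, Real.sqrt_pos.2 hr0, by rw [Real.sqrt_lt' one_pos]; simpa using hr2, ?_, ?_⟩ <;>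
    rw [Real.sq_sqrt hr0.le]
  · exact fun k => (hi k).trans_lt ((le_max_left _ _).trans_lt hr1)
  · exact fun k => (hj k).trans_lt ((le_max_right _ _).trans_lt hr1)

theorem exists_summable_bound_schur_mul_schur {N : ℕ} {s : ℝ} (hs0 : 0 < s) (hs1 : s < 1) :
    ∃ B : (Fin N → ℕ) → ℝ, Summable B ∧ ∀ (a : Fin N → ℕ) (u v : Fin (N + 1) → ℂ),
      (∀ k, ‖u k‖ < s ^ 2) → (∀ k, ‖v k‖ < s ^ 2) →
      ‖schur (highestWeight a) u * schur (highestWeight a) v‖ ≤ B a := by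
  have hq : ∀ _ : Fin N, ‖s ^ 2‖ < 1 := fun _ => by
    rw [Real.norm_of_nonneg (sq_nonneg s)]
    nlinarith
  have hsum := (hasSum_prod_pow hq).1.summable
  refine ⟨_, hsum.mul_left (2 * ∏ _i : Fin (N + 1), ∏ _j : Fin (N + 1), (1 - s ^ 2)⁻¹), ?_⟩
  intro a u v hu hv
  have h1 := norm_schur_le hs0 hs1 hu a
  have h2 := norm_schur_le hs0 hs1 hv a
  rw [norm_mul]
  refine (le_div_iff₀' two_pos).2 (mul_assoc (2 : ℝ) _ _ ▸ two_mul_le_add_sq _ _) |>.trans ?_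
  linarith

/-- The Cauchy identity for the Schur polynomials of `N + 1` variables, summed over the partitions
with at most `N` parts. -/
theorem hasSum_schur_mul_schur {N : ℕ} {u v : Fin (N + 1) → ℂ} (hu : ∀ k, ‖u k‖ < 1)
    (hv : ∀ k, ‖v k‖ < 1) :
    HasSum (fun a : Fin N → ℕ => schur (highestWeight a) u * schur (highestWeight a) v)
      ((1 - (∏ i, u i) * ∏ i, v i) * ∏ i, ∏ j, (1 - u i * v j)⁻¹) := by
  obtain ⟨s, hs0, hs1, hus, hvs⟩ := exists_norm_lt_sq hu hv
  obtain ⟨B, hB, hle⟩ := exists_summable_bound_schur_mul_schur (N := N) hs0 hs1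
  have hs2 : s ^ 2 < 1 := by nlinarith
  have hDo : IsOpen {p : (Fin (N + 1) → ℂ) × (Fin (N + 1) → ℂ) |
      (∀ k, ‖p.1 k‖ < s ^ 2) ∧ ∀ k, ‖p.2 k‖ < s ^ 2} := isOpen_polydisc _ _
  have hD := hDo.mem_nhds (x := (u, v)) ⟨hus, hvs⟩
  -- The bound B is uniform on the polydisc of radius s², so the sum is continuous there and the
  -- identity extends from distinct coordinates.
  have hcont := continuousOn_tsum (f := fun (a : Fin N → ℕ) (p : _ × _) =>
    schur (highestWeight a) p.1 * schur (highestWeight a) p.2)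
    (fun a => (((continuous_schur _).comp continuous_fst).mul
      ((continuous_schur _).comp continuous_snd)).continuousOn) hB
    (fun a p (hp : (∀ k, ‖p.1 k‖ < s ^ 2) ∧ ∀ k, ‖p.2 k‖ < s ^ 2) => hle a p.1 p.2 hp.1 hp.2)
  have heq := ((dense_setOf_injective (N + 1)).prod (dense_setOf_injective (N + 1))).eq_of_eventually
    (x := (u, v)) (hcont.continuousAt hD)
    ((continuousOn_prod_one_sub_mul_inv (N + 1)).continuousAt
      ((isOpen_polydisc (N + 1) 1).mem_nhds ⟨hu, hv⟩)) (by
    filter_upwards [hD] with p hp hi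
    exact (hasSum_schur_mul_schur_of_injective (fun k => (hp.1 k).trans hs2)
      (fun k => (hp.2 k).trans hs2) hi.1 hi.2).tsum_eq)
  have h : Summable fun a : Fin N → ℕ => schur (highestWeight a) u * schur (highestWeight a) v :=
    Summable.of_norm_bounded hB fun a => hle a u v hus hvs
  rw [← heq]
  exact h.hasSum

/-! ### Weights and plethystic exponentials -/

theorem fundWeight_pow {r : ℕ} (x : Fin r → ℂ) (m : ℕ) (k : Fin (r + 1)) :
    fundWeight (x ^ m) k = fundWeight x k ^ m := by
  have h1 : (Fin.snoc (x ^ m) 1 : Fin (r + 1) → ℂ) k = (Fin.snoc x 1 : Fin (r + 1) → ℂ) k ^ m := by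
    refine Fin.lastCases ?_ (fun i => ?_) k <;> simp
  have h2 : (Fin.cons 1 (x ^ m) : Fin (r + 1) → ℂ) k = (Fin.cons 1 x : Fin (r + 1) → ℂ) k ^ m := by
    refine Fin.cases ?_ (fun i => ?_) k <;> simp
  rw [fundWeight, fundWeight, h1, h2, div_pow]

theorem fundWeight_ne_zero {r : ℕ} {x : Fin r → ℂ} (hx : ∀ i, x i ≠ 0) (k : Fin (r + 1)) :
    fundWeight x k ≠ 0 := by
  refine div_ne_zero ?_ ?_
  · refine Fin.lastCases ?_ (fun i => ?_) k <;> simp [hx]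
  · refine Fin.cases ?_ (fun i => ?_) k <;> simp [hx]

/-- The product telescopes: this is the determinant-one condition of SU(r+1). -/
theorem prod_fundWeight {r : ℕ} {x : Fin r → ℂ} (hx : ∀ i, x i ≠ 0) :
    ∏ k, fundWeight x k = 1 := by
  simp only [fundWeight, Finset.prod_div_distrib]
  rw [Fin.prod_univ_castSucc, Fin.prod_univ_succ (Fin.cons 1 x : Fin (r + 1) → ℂ)]
  simp [div_self (Finset.prod_ne_zero_iff.2 fun i _ => hx i)]

theorem fundWeight_one (r : ℕ) (k : Fin (r + 1)) : fundWeight (1 : Fin r → ℂ) k = 1 := by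
  have := fundWeight_pow (1 : Fin r → ℂ) 0 k
  simpa using this

/-- The plethystic exponential of a sum of monomials `c_i`. -/
theorem hasSum_sum_pow_div {ι : Type*} [Fintype ι] {c : ι → ℂ} (hc : ∀ i, ‖c i‖ < 1) :
    HasSum (fun r : ℕ => (∑ i, c i ^ (r + 1)) / ((r : ℂ) + 1)) (∑ i, -Complex.log (1 - c i)) := by
  simp_rw [Finset.sum_div]
  exact hasSum_sum fun i _ => by simpa using Complex.hasSum_taylorSeries_neg_log' (hc i)

theorem PEConverges_of_eq_sum_pow {M ι : Type*} [Monoid M] [Fintype ι] {g : M → ℂ} {v : M}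
    {c : ι → ℂ} (hg : ∀ m, g (v ^ m) = ∑ i, c i ^ m) (hc : ∀ i, ‖c i‖ < 1) : PEConverges g v := by
  unfold PEConverges
  simp_rw [hg]
  exact (hasSum_sum_pow_div hc).summable

/-- For a sum of monomials with values `c i`, the exponent is a sum of -log(1 - c_i), and the
exponential inverts each logarithm. -/
theorem PE_of_eq_sum_pow {M ι : Type*} [Monoid M] [Fintype ι] {g : M → ℂ} {v : M}
    {c : ι → ℂ} (hg : ∀ m, g (v ^ m) = ∑ i, c i ^ m) (hc : ∀ i, ‖c i‖ < 1) :
    PE g v = ∏ i, (1 - c i)⁻¹ := by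
  unfold PE
  simp_rw [hg]
  rw [(hasSum_sum_pow_div hc).tsum_eq, Complex.exp_sum]
  refine Finset.prod_congr rfl fun i _ => ?_
  rw [Complex.exp_neg, Complex.exp_log (one_sub_ne_zero_of_norm_lt (hc i))]

theorem quarkChar_pow {r N : ℕ} (t t' : ℂ) (x y : Fin r → ℂ) (z : Fin N → ℂ) (m : ℕ) :
    quarkChar ((t, t', x, y, z) ^ m) =
      ∑ i : (Fin (r + 1) × Fin N) ⊕ (Fin (r + 1) × Fin N),
        (Sum.elim (fun p => t * fundWeight x p.1 * (z p.2)⁻¹)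
          (fun p => t' * (fundWeight y p.1)⁻¹ * z p.2) i) ^ m := by
  simp only [Prod.pow_mk, quarkChar, fundChar, antiFundChar, fundWeight_pow, Pi.pow_apply,
    Fintype.sum_sum_type, Sum.elim_inl, Sum.elim_inr, Fintype.sum_prod_type, mul_pow, inv_pow,
    Finset.mul_sum, Finset.sum_mul]
  rw [Finset.sum_comm, Finset.sum_comm (f := fun i k => t' ^ m * (fundWeight y i ^ m)⁻¹ * _)]

theorem mesonChar_pow {r : ℕ} (t t' : ℂ) (x y : Fin r → ℂ) (m : ℕ) :
    mesonChar ((t, t', x, y) ^ m) = ∑ i : Fin (r + 1) × Fin (r + 1),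
      ((t * fundWeight x i.1) * (t' * (fundWeight y i.2)⁻¹)) ^ m := by
  simp only [Prod.pow_mk, mesonChar, fundChar, antiFundChar, fundWeight_pow,
    Fintype.sum_prod_type, mul_pow, inv_pow, Finset.sum_mul]
  refine Finset.sum_congr rfl fun i _ => ?_
  rw [Finset.mul_sum, Finset.sum_mul]
  exact Finset.sum_congr rfl fun j _ => by ring

theorem norm_quark_lt_one {r N : ℕ} {t t' : ℂ} {x y : Fin r → ℂ} {z : Fin N → ℂ}
    (hx : ∀ k, ‖t * fundWeight x k‖ < 1) (hy : ∀ k, ‖t' * (fundWeight y k)⁻¹‖ < 1)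
    (hz : ∀ a, ‖z a‖ = 1) (i : (Fin (r + 1) × Fin N) ⊕ (Fin (r + 1) × Fin N)) :
    ‖Sum.elim (fun p => t * fundWeight x p.1 * (z p.2)⁻¹)
          (fun p => t' * (fundWeight y p.1)⁻¹ * z p.2) i‖ < 1 := by
  rcases i with p | p
  · exact norm_mul_lt_one (hx _) (by simp [hz])
  · exact norm_mul_lt_one (hy _) (by simp [hz])

theorem PE_quarkChar {r N : ℕ} {t t' : ℂ} {x y : Fin r → ℂ} {z : Fin N → ℂ}
    (hx : ∀ k, ‖t * fundWeight x k‖ < 1) (hy : ∀ k, ‖t' * (fundWeight y k)⁻¹‖ < 1)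
    (hz : ∀ a, ‖z a‖ = 1) :
    PE quarkChar (t, t', x, y, z) =
      cauchyKernel (fun k => t * fundWeight x k) (fun k => t' * (fundWeight y k)⁻¹) z := by
  rw [PE_of_eq_sum_pow (quarkChar_pow t t' x y z) (norm_quark_lt_one hx hy hz)]
  simp only [cauchyKernel, Fintype.prod_sum_type, Fintype.prod_prod_type, Sum.elim_inl, Sum.elim_inr]

theorem PE_mesonChar {r : ℕ} {t t' : ℂ} {x y : Fin r → ℂ}
    (hx : ∀ k, ‖t * fundWeight x k‖ < 1) (hy : ∀ k, ‖t' * (fundWeight y k)⁻¹‖ < 1) :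
    PE mesonChar (t, t', x, y) =
      ∏ i, ∏ j, (1 - (t * fundWeight x i) * (t' * (fundWeight y j)⁻¹))⁻¹ := by
  rw [PE_of_eq_sum_pow (mesonChar_pow t t' x y) fun i => norm_mul_lt_one (hx _) (hy _).le,
    Fintype.prod_prod_type]

/-! ### Evaluation of the Hilbert series -/

theorem hilbertSeries_eq_haarIntegral {r N : ℕ} {t t' : ℂ} {x y : Fin r → ℂ}
    (hx : ∀ k, ‖t * fundWeight x k‖ < 1) (hy : ∀ k, ‖t' * (fundWeight y k)⁻¹‖ < 1) :
    hilbertSeries r N t t' x y =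
      haarIntegral N (cauchyKernel (fun k => t * fundWeight x k)
        fun k => t' * (fundWeight y k)⁻¹) := by
  rw [hilbertSeries, haarIntegral, haarIntegral]
  congr 1
  exact torusIntegral_congr fun z hz => by rw [PE_quarkChar hx hy hz]

theorem hilbertSeries_eq {N : ℕ} {t t' : ℂ} {x y : Fin N → ℂ} (hx0 : ∀ i, x i ≠ 0)
    (hy0 : ∀ i, y i ≠ 0) (hx : ∀ k, ‖t * fundWeight x k‖ < 1)
    (hy : ∀ k, ‖t' * (fundWeight y k)⁻¹‖ < 1) :
    hilbertSeries N N t t' x y = (1 - (t * t') ^ (N + 1)) *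
      ∏ i, ∏ j, (1 - (t * fundWeight x i) * (t' * (fundWeight y j)⁻¹))⁻¹ := by
  rw [hilbertSeries_eq_haarIntegral hx hy, haarIntegral_cauchyKernel hx hy,
    Finset.prod_mul_distrib, Finset.prod_mul_distrib, prod_fundWeight hx0, Finset.prod_inv_distrib,
    prod_fundWeight hy0]
  simp only [Finset.prod_const, Finset.card_univ, Fintype.card_fin, inv_one, mul_one, ← mul_pow]

/-- Homogeneity extracts (t t')^{|λ|}; at the inverse weights of y duality reverses the label, with
no determinant factor because the weights multiply to 1. -/
theorem schur_mul_schur_eq {N : ℕ} (t t' : ℂ) {x y : Fin N → ℂ} (hy0 : ∀ i, y i ≠ 0)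
    (a : Fin N → ℕ) :
    schur (highestWeight a) (fun k => t * fundWeight x k) *
      schur (highestWeight a) (fun k => t' * (fundWeight y k)⁻¹) =
    dynkinChar a x * dynkinChar (fun j => a (Fin.rev j)) y *
      (t * t') ^ (∑ j : Fin N, ((j : ℕ) + 1) * a j) := by
  have h := schur_inv (highestWeight a) (highestWeight_le a) (fundWeight_ne_zero hy0)
  rw [prod_fundWeight hy0, one_pow, one_mul] at h
  have h2 : (fun j => highestWeight a 0 - highestWeight a (Fin.rev j)) =
      highestWeight fun k => a (Fin.rev k) := funext fun j => (highestWeight_comp_rev a j).symm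
  rw [schur_const_mul, schur_const_mul, h, h2, sum_highestWeight, mul_pow]
  change _ = schur _ _ * schur _ _ * _
  ring

end SQCD

theorem mainTheorem3 (Nc : ℕ) (hNc : 1 ≤ Nc) :
    (∀ (t t' : ℂ) (x y : Fin Nc → ℂ), (∀ i, x i ≠ 0) → (∀ i, y i ≠ 0) →
      (∀ k, ‖t * SQCD.fundWeight x k‖ < 1) → (∀ k, ‖t' * (SQCD.fundWeight y k)⁻¹‖ < 1) →
      (∀ z : Fin Nc → ℂ, (∀ a, ‖z a‖ = 1) →
        SQCD.PEConverges SQCD.quarkChar (t, t', x, y, z)) ∧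
      SQCD.HaarIntegrable Nc (fun z => SQCD.PE SQCD.quarkChar (t, t', x, y, z)) ∧
      SQCD.PEConverges SQCD.mesonChar (t, t', x, y) ∧
      SQCD.hilbertSeries Nc Nc t t' x y =
        (1 - (t * t') ^ (Nc + 1)) * SQCD.PE SQCD.mesonChar (t, t', x, y) ∧
      HasSum (fun n : Fin Nc → ℕ =>
          SQCD.dynkinChar n x * SQCD.dynkinChar (fun j => n (Fin.rev j)) y *
            (t * t') ^ (∑ j : Fin Nc, ((j : ℕ) + 1) * n j))
        (SQCD.hilbertSeries Nc Nc t t' x y)) ∧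
    (∀ t t' : ℂ, ‖t‖ < 1 → ‖t'‖ < 1 →
      SQCD.hilbertSeries Nc Nc t t' 1 1 = (1 - (t * t') ^ (Nc + 1)) / (1 - t * t') ^ ((Nc + 1) ^ 2)) := by
  open SQCD in
  refine ⟨fun t t' x y hx0 hy0 hx hy => ⟨fun z hz => ?_, ?_, ?_, ?_, ?_⟩, fun t t' ht ht' => ?_⟩
  · exact PEConverges_of_eq_sum_pow (quarkChar_pow t t' x y z) (norm_quark_lt_one hx hy hz)
  · exact TorusIntegrable.congr (haarIntegrable_cauchyKernel hx hy) fun z hz =>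
      congrArg _ (PE_quarkChar hx hy hz)
  · exact PEConverges_of_eq_sum_pow (mesonChar_pow t t' x y) fun i => norm_mul_lt_one (hx _) (hy _).le
  · rw [hilbertSeries_eq hx0 hy0 hx hy, PE_mesonChar hx hy]
  · simp_rw [← schur_mul_schur_eq t t' hy0]
    rw [hilbertSeries_eq_haarIntegral hx hy, haarIntegral_cauchyKernel hx hy]
    exact hasSum_schur_mul_schur hx hy
  -- At x = y = 1 all weights are 1, so the (Nc + 1)² factors coincide.
  · rw [hilbertSeries_eq (by simp) (by simp) (by simpa [fundWeight_one] using ht)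
      (by simpa [fundWeight_one] using ht')]
    simp [fundWeight_one, div_eq_mul_inv, ← pow_mul, sq]
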